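/- Let $G$ be a finite simple $3$-regular graph with at least one vertex, and let $q \ge 2$ be an integer. For a finite graph $H$ write $C_q(H)$ for the number of proper $q$-colorings of $H$, i.e. maps $V(H) \to \{1,\dots,q\}$ giving different values to the two endpoints of every edge, and let $K_{3,3}$ be the complete bipartite graph with three vertices in each part. Then \[ C_q(G)^{1/|V(G)|} \le C_q(K_{3,3})^{1/6}, \] with equality if and only if $G$ is a vertex-disjoint union of copies of $K_{3,3}$. -/

import Mathlib

/-- The number of proper `q`-colorings of `G`. -/
noncomputable def numColorings {V : Type*} (G : SimpleGraph V) (q : ℕ) : ℕ :=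
  Nat.card (G.Coloring (Fin q))

/-- The vertex-disjoint union of copies of `H`, one for each element of `ι`. -/
def disjointCopies (ι : Type*) {W : Type*} (H : SimpleGraph W) : SimpleGraph (ι × W) where
  Adj a b := a.1 = b.1 ∧ H.Adj a.2 b.2
  symm := ⟨fun _ _ h => ⟨h.1.symm, h.2.symm⟩⟩
  loopless := ⟨fun _ h => H.irrefl h.2⟩

/-- `G` is a (vertex-disjoint) union of finitely many copies of `H`. -/
def IsUnionOfCopies {V W : Type*} (G : SimpleGraph V) (H : SimpleGraph W) : Prop :=
  ∃ k : ℕ, Nonempty (G ≃g disjointCopies (Fin k) H)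

/-! Write `q ^ n * ρ ^ e` for the target on a graph with `n` vertices and `e` edges, where `ρ` is
the homomorphism density of `K_{3,3}` into `K_q`, raised to the power `1/9`. A cubic graph has `3n =
2e`, so this target is exactly `C_q(K_{3,3}) ^ (n / 6)`. The bound is proved for all graphs of
maximum degree at most 3, a class closed under deletion.

For triangle-free graphs a stronger statement, with arbitrary lists, is available: the number of
list colorings is at most the product over edges `uv` of the count for `K_{d(u), d(v)}` to the power
`1 / (d(u) d(v))`, with the list sizes of isolated vertices as extra factors
(`listCount_le_edgeBound`). One removes a vertex `w` of maximum degree and conditions on its color.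
Triangle-freeness makes the bound factor over the neighbors of `w`, Hölder separates these factors,
and each one is controlled by `sum_rpow_bipCount_erase_le`. Monotonicity of power means then turns
the edge product into `q ^ n * ρ ^ e` (`edgeBound_univ_le`).

If there is a triangle, its three vertices are removed together. With `k` outgoing edges, the
colorings lost amount to a factor strictly below `(1 - 1/q) ^ (3 + k)`, and `1 - 1/q ≤ ρ`, so the
inequality is strict.

For equality in the triangle-free cubic case, suppose `w` and `x` share a neighbor `u` while `x` has
a neighbor `v` outside `N(w)`. Once `w` has color `c`, repeating `c` at `x` is strictly favorable at
`u` but never favorable at `v`, so Hölder at `x` is strict (`listCount_condList_lt_edgeBound`).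
Without such a configuration, vertices with a common neighbor have equal neighborhoods, which forces
every component to be `K_{3,3}`. -/

open Finset

/-! ### Hölder's inequality for finite products, with a strictness criterion -/

section Holder

/-- Hölder's inequality for a product of finitely many functions, in power form. -/
theorem sum_prod_le_prod_of_sum_pow_le {ι γ : Type*} {U : Finset ι} (hU : U.Nonempty)
    {C : Finset γ} {F : ι → γ → ℝ} {Ψ : ι → ℝ} (hF : ∀ u ∈ U, ∀ c ∈ C, 0 ≤ F u c)
    (hΨ : ∀ u ∈ U, 0 ≤ Ψ u) (h : ∀ u ∈ U, ∑ c ∈ C, F u c ^ #U ≤ Ψ u ^ #U) :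
    ∑ c ∈ C, ∏ u ∈ U, F u c ≤ ∏ u ∈ U, Ψ u ∧
    ((∀ u ∈ U, 0 < Ψ u) → (∃ u ∈ U, ∃ v ∈ U, ∃ c ∈ C, ∃ d ∈ C, F u d < F u c ∧ F v c ≤ F v d) →
      ∑ c ∈ C, ∏ u ∈ U, F u c < ∏ u ∈ U, Ψ u) := by
  have hn : #U ≠ 0 := by simpa [Finset.card_eq_zero] using hU.ne_empty
  have hn' : (0 : ℝ) < #U := by positivity
  by_cases hpos : ∀ u ∈ U, 0 < Ψ u
  · have hP : 0 < ∏ u ∈ U, Ψ u := prod_pos hpos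
    -- After normalization the claim is weighted AM-GM at each point `c`, with equal weights `1 /
    -- #U`, summed over `c`.
    set z : ι → γ → ℝ := fun u c => (F u c / Ψ u) ^ #U with hz
    have hz0 : ∀ c ∈ C, ∀ u ∈ U, 0 ≤ z u c := fun c hc u hu =>
      pow_nonneg (div_nonneg (hF u hu c hc) (hΨ u hu)) _
    have hw0 : ∀ i ∈ U, (0 : ℝ) < 1 / #U := fun _ _ => by positivity
    have hw1 : ∑ _i ∈ U, (1 : ℝ) / #U = 1 := by
      rw [sum_const, nsmul_eq_mul]; field_simp
    have hprod : ∀ c ∈ C, ∏ u ∈ U, z u c ^ ((1 : ℝ) / #U) = (∏ u ∈ U, F u c) / ∏ u ∈ U, Ψ u := by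
      intro c hc
      rw [← prod_div_distrib]
      refine prod_congr rfl fun u hu => ?_
      rw [one_div]
      exact Real.pow_rpow_inv_natCast (div_nonneg (hF u hu c hc) (hΨ u hu)) hn
    have hle : ∀ c ∈ C, (∏ u ∈ U, F u c) / ∏ u ∈ U, Ψ u ≤ ∑ u ∈ U, 1 / (#U : ℝ) * z u c := by
      intro c hc
      rw [← hprod c hc]
      exact Real.geom_mean_le_arith_mean_weighted U _ _ (fun i hi => (hw0 i hi).le) hw1
        (hz0 c hc)
    have hsum : ∑ c ∈ C, ∑ u ∈ U, 1 / (#U : ℝ) * z u c ≤ 1 := by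
      rw [sum_comm]
      refine le_of_le_of_eq (sum_le_sum fun u hu => ?_) hw1
      rw [← mul_sum]
      refine mul_le_of_le_one_right (hw0 u hu).le ?_
      simp only [hz, div_pow]
      rw [← sum_div]
      exact (div_le_one (pow_pos (hpos u hu) _)).2 (h u hu)
    constructor
    · rw [← div_le_one hP, sum_div]
      exact (sum_le_sum hle).trans hsum
    · rintro - ⟨u, hu, v, hv, c, hc, d, hd, h1, h2⟩
      rw [← div_lt_one hP, sum_div]
      refine lt_of_lt_of_le (sum_lt_sum hle ?_) hsum
      by_contra! hcon
      -- Equality in AM-GM makes all normalized factors agree at every point, which is impossible if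
      -- `F u` and `F v` order `c` and `d` oppositely.
      have key : ∀ e ∈ C, z u e = z v e := by
        intro e he
        have h3 := hcon e he
        rw [← hprod e he] at h3
        exact (Real.geom_mean_eq_arith_mean_weighted_iff_of_pos U _ _ hw0 hw1 (hz0 e he)).1
          (le_antisymm (Real.geom_mean_le_arith_mean_weighted U _ _ (fun i hi => (hw0 i hi).le)
            hw1 (hz0 e he)) h3) u hu v hv
      have h4 : z u d < z u c := by
        refine pow_lt_pow_left₀ ?_ (div_nonneg (hF u hu d hd) (hΨ u hu)) hn
        exact div_lt_div_of_pos_right h1 (hpos u hu)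
      have h5 : z v c ≤ z v d := by
        refine pow_le_pow_left₀ (div_nonneg (hF v hv c hc) (hΨ v hv)) ?_ _
        exact div_le_div_of_nonneg_right h2 (hΨ v hv)
      rw [key d hd, key c hc] at h4
      exact absurd h5 (not_le.2 h4)
  -- If some `Ψ u` is zero, then `F u` vanishes on `C` and both sides are zero.
  · refine ⟨?_, fun h' => absurd h' hpos⟩
    push Not at hpos
    obtain ⟨u, hu, hu0⟩ := hpos
    have hu1 : Ψ u = 0 := le_antisymm hu0 (hΨ u hu)
    have h1 := h u hu
    rw [hu1, zero_pow hn] at h1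
    have h2 : ∀ c ∈ C, F u c = 0 := by
      intro c hc
      have := (sum_eq_zero_iff_of_nonneg (fun c hc => pow_nonneg (hF u hu c hc) _)).1
        (le_antisymm h1 (sum_nonneg fun c hc => pow_nonneg (hF u hu c hc) _)) c hc
      exact pow_eq_zero_iff hn |>.1 this
    rw [prod_eq_zero hu hu1]
    exact (sum_eq_zero fun c hc => prod_eq_zero hu (h2 c hc)).le

end Holder

/-! ### List colorings of complete bipartite graphs and the local inequality -/

section Bipartite

variable {α : Type*} [DecidableEq α]

/-- The elements of `L` not among the values of `y`. -/
def avoid (L : Finset α) {n : ℕ} (y : Fin n → α) : Finset α := {z ∈ L | ∀ j, z ≠ y j}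

theorem mem_avoid {L : Finset α} {n : ℕ} {y : Fin n → α} {z : α} :
    z ∈ avoid L y ↔ z ∈ L ∧ ∀ j, z ≠ y j := by simp [avoid]

/-- The number of list colorings of the complete bipartite graph with `a` vertices with list `M`
and `b` vertices with list `L`. -/
def bipCount (a b : ℕ) (L M : Finset α) : ℝ :=
  ∑ y ∈ Fintype.piFinset (fun _ : Fin a => M), (#(avoid L y) : ℝ) ^ b

theorem bipCount_nonneg (a b : ℕ) (L M : Finset α) : 0 ≤ bipCount a b L M :=
  sum_nonneg fun _ _ => by positivity

/-- Expand the power into a sum over tuples `y` and exchange the sums: `y` avoids `x` exactly when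
`x` avoids `y`. This counts weighted colorings of `K_{a,b}` from either side. -/
theorem sum_pow_sum_avoid (a b : ℕ) (L C : Finset α) (W : α → ℝ) :
    ∑ x ∈ Fintype.piFinset (fun _ : Fin b => L), (∑ c ∈ avoid C x, W c) ^ a =
      ∑ y ∈ Fintype.piFinset (fun _ : Fin a => C), (∏ j, W (y j)) * (#(avoid L y) : ℝ) ^ b := by
  have h1 : ∀ y : Fin a → α, (∏ j, W (y j)) * (#(avoid L y) : ℝ) ^ b =
      ∑ x ∈ Fintype.piFinset (fun _ : Fin b => avoid L y), ∏ j, W (y j) := by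
    intro y
    rw [sum_const, Fintype.card_piFinset_const, nsmul_eq_mul, mul_comm]
    push_cast; rfl
  simp_rw [h1, sum_pow']
  refine sum_comm' fun x y => ?_
  simp only [Fintype.mem_piFinset, mem_avoid]
  constructor
  · rintro ⟨h1, h2⟩
    exact ⟨fun i => ⟨h1 i, fun j => ((h2 j).2 i).symm⟩, fun j => (h2 j).1⟩
  · rintro ⟨h1, h2⟩
    exact ⟨fun i => (h1 i).1, fun j => ⟨h2 j, fun i => ((h1 i).2 j).symm⟩⟩

theorem bipCount_comm (a b : ℕ) (L M : Finset α) : bipCount a b L M = bipCount b a M L := by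
  have := sum_pow_sum_avoid a b L M (fun _ => 1)
  simp only [sum_const, nsmul_eq_mul, mul_one, prod_const_one, one_mul] at this
  exact this.symm

theorem bipCount_pos {a b : ℕ} {L M : Finset α} {l m : α} (hl : l ∈ L) (hm : m ∈ M) (h : l ≠ m) :
    0 < bipCount a b L M := by
  refine sum_pos' (fun _ _ => by positivity) ⟨fun _ => m, by simp [hm], ?_⟩
  have : 0 < #(avoid L fun _ : Fin a => m) := card_pos.2 ⟨l, mem_avoid.2 ⟨hl, fun _ => h⟩⟩
  positivity

/-- The local step for a path `w`, `u`, `v`: `u` has degree `a + 1` and list `L`, `v` has degree `b`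
and list `M`, and `w` has degree `Δ` and list `C`; deleting `w` with color `c` erases `c` from `L`.
Two uses of Hölder bound the left side `S` by a power of itself, of exponent less than 1, times
counts for the two edges; solving for `S` gives the result. The condition `b ≤ Δ` makes `p = Δ / b`
at least 1, which is why a vertex of maximum degree is removed. -/
theorem sum_rpow_bipCount_erase_le {a b Δ : ℕ} (ha : 1 ≤ a) (hb : 1 ≤ b) (hΔ : b ≤ Δ)
    (L M C : Finset α) :
    ∑ c ∈ C, bipCount a b (L.erase c) M ^ ((Δ : ℝ) / b) ≤
      bipCount (a + 1) Δ L C ^ (1 / ((a : ℝ) + 1)) *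
        bipCount (a + 1) b L M ^ ((Δ : ℝ) / b * (a / (a + 1))) := by
  have ha0 : (0 : ℝ) < a := by exact_mod_cast ha
  have hb0 : (0 : ℝ) < b := by exact_mod_cast hb
  have hΔ0 : (0 : ℝ) < Δ := by exact_mod_cast (hb.trans hΔ)
  set p : ℝ := (Δ : ℝ) / b with hp
  have hp0 : 0 < p := by positivity
  have hp1 : 1 ≤ p := (one_le_div hb0).2 (by exact_mod_cast hΔ)
  set A : α → ℝ := fun c => bipCount a b (L.erase c) M with hA
  have hA0 : ∀ c, 0 ≤ A c := fun c => bipCount_nonneg _ _ _ _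
  set S := ∑ c ∈ C, A c ^ p with hS
  have hS0 : 0 ≤ S := sum_nonneg fun c _ => Real.rpow_nonneg (hA0 c) _
  set K := bipCount (a + 1) Δ L C with hK
  set J := bipCount (a + 1) b L M with hJ
  have hK0 : 0 ≤ K := bipCount_nonneg _ _ _ _
  have hJ0 : 0 ≤ J := bipCount_nonneg _ _ _ _
  set X := Fintype.piFinset (fun _ : Fin b => L) with hX
  set Y := Fintype.piFinset (fun _ : Fin (a + 1) => C) with hY
  set Z := ∑ y ∈ Y, (∏ j, A (y j) ^ (p - 1)) * (#(avoid L y) : ℝ) ^ b with hZ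
  have hZ0 : 0 ≤ Z := sum_nonneg fun y _ => mul_nonneg
    (prod_nonneg fun j _ => Real.rpow_nonneg (hA0 _) _) (by positivity)
  -- Split `A c ^ p` as `A c ^ (p - 1) * A c` and expand only the last factor over colorings `x` of
  -- the side with list `L`.
  have hS1 : S = ∑ x ∈ X, (∑ c ∈ avoid C x, A c ^ (p - 1)) * (#(avoid M x) : ℝ) ^ a := by
    have h1 : ∀ c, A c ^ p = ∑ x ∈ Fintype.piFinset (fun _ : Fin b => L.erase c),
        A c ^ (p - 1) * (#(avoid M x) : ℝ) ^ a := by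
      intro c
      rw [← mul_sum]
      have h2 : A c = ∑ x ∈ Fintype.piFinset (fun _ : Fin b => L.erase c),
          (#(avoid M x) : ℝ) ^ a := bipCount_comm _ _ _ _
      rw [← h2]
      rcases (hA0 c).eq_or_lt with h | h
      · rw [← h, mul_zero, Real.zero_rpow hp0.ne']
      · rw [Real.rpow_sub_one h.ne']; field_simp
    simp_rw [hS, h1, sum_mul]
    refine sum_comm' fun c x => ?_
    simp only [hX, Fintype.mem_piFinset, mem_avoid, mem_erase]
    constructor
    · rintro ⟨h1, h2⟩
      exact ⟨⟨h1, fun i => (h2 i).1.symm⟩, fun i => (h2 i).2⟩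
    · rintro ⟨⟨h1, h2⟩, h3⟩
      exact ⟨h1, fun i => ⟨(h2 i).symm, h3 i⟩⟩
  have hconj : ((a : ℝ) + 1).HolderConjugate (((a : ℝ) + 1) / a) := by
    rw [Real.holderConjugate_iff]
    constructor
    · linarith
    · field_simp; ring
  have hS2 : S ≤ Z ^ (1 / ((a : ℝ) + 1)) * J ^ ((a : ℝ) / (a + 1)) := by
    have h := Real.inner_le_Lp_mul_Lq_of_nonneg X
      (f := fun x => ∑ c ∈ avoid C x, A c ^ (p - 1)) (g := fun x => (#(avoid M x) : ℝ) ^ a) hconj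
      (fun x _ => sum_nonneg fun c _ => Real.rpow_nonneg (hA0 c) _) (fun x _ => by positivity)
    rw [← hS1] at h
    have h1 : ∑ x ∈ X, (∑ c ∈ avoid C x, A c ^ (p - 1)) ^ ((a : ℝ) + 1) = Z := by
      refine Eq.trans ?_ (sum_pow_sum_avoid (a + 1) b L C fun c => A c ^ (p - 1))
      refine sum_congr rfl fun x _ => ?_
      rw [← Real.rpow_natCast]; push_cast; rfl
    have h2 : ∑ x ∈ X, ((#(avoid M x) : ℝ) ^ a) ^ (((a : ℝ) + 1) / a) = J := by
      rw [hJ, bipCount_comm]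
      refine sum_congr rfl fun x _ => ?_
      rw [← Real.rpow_natCast, ← Real.rpow_mul (by positivity), ← Real.rpow_natCast]
      congr 1; push_cast; field_simp
    rw [h1, h2] at h
    convert h using 3
    field_simp
  -- `Z` is a weighted count for `K_{a+1,b}`. Hölder with exponents `p / (p - 1)` and `p` recovers
  -- `S ^ (a + 1)` from the weights and `K` from the rest; for `p = 1` the weights are trivial and
  -- `Z = K`.
  have hZ1 : Z ≤ S ^ (((a : ℝ) + 1) * ((p - 1) / p)) * K ^ (1 / p) := by
    rcases hp1.eq_or_lt with h | h
    · have hbΔ : b = Δ := by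
        have : (Δ : ℝ) = b := by
          have := h.symm; rw [hp, div_eq_one_iff_eq hb0.ne'] at this; exact this
        exact_mod_cast this.symm
      have : Z = K := by
        simp [hZ, hK, ← h, bipCount, hY, hbΔ]
      rw [this, ← h]; simp
    · have hconj2 : (p / (p - 1)).HolderConjugate p := by
        rw [Real.holderConjugate_comm]
        exact Real.HolderConjugate.conjExponent h
      have h3 := Real.inner_le_Lp_mul_Lq_of_nonneg Y
        (f := fun y => ∏ j, A (y j) ^ (p - 1)) (g := fun y => (#(avoid L y) : ℝ) ^ b) hconj2
        (fun y _ => prod_nonneg fun j _ => Real.rpow_nonneg (hA0 _) _) (fun x _ => by positivity)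
      have hp10 : 0 < p - 1 := by linarith
      have h1 : ∑ y ∈ Y, (∏ j, A (y j) ^ (p - 1)) ^ (p / (p - 1)) = S ^ (a + 1) := by
        rw [hS, sum_pow']
        refine sum_congr rfl fun y _ => ?_
        rw [← Real.finsetProd_rpow _ _ fun j _ => Real.rpow_nonneg (hA0 _) _]
        refine prod_congr rfl fun j _ => ?_
        rw [← Real.rpow_mul (hA0 _)]
        congr 1; field_simp
      have h2 : ∑ y ∈ Y, ((#(avoid L y) : ℝ) ^ b) ^ p = K := by
        refine sum_congr rfl fun x _ => ?_
        rw [← Real.rpow_natCast, ← Real.rpow_mul (by positivity), ← Real.rpow_natCast]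
        congr 1; rw [hp]; field_simp
      rw [h1, h2, ← Real.rpow_natCast, ← Real.rpow_mul hS0] at h3
      convert h3 using 3
      push_cast; field_simp
  rcases hS0.eq_or_lt with h | h
  · rw [← h]; positivity
  have hS3 : S ≤ S ^ ((p - 1) / p) * (K ^ (1 / (p * ((a : ℝ) + 1))) * J ^ ((a : ℝ) / (a + 1))) := by
    refine hS2.trans ?_
    rw [← mul_assoc]
    refine mul_le_mul_of_nonneg_right ?_ (by positivity)
    refine (Real.rpow_le_rpow hZ0 hZ1 (by positivity)).trans_eq ?_
    rw [Real.mul_rpow (by positivity) (by positivity), ← Real.rpow_mul hS0, ← Real.rpow_mul hK0]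
    congr 2 <;> field_simp
  -- Cancel the power of `S` on the right, which is legitimate because `S > 0`.
  have hS4 : S ^ (1 / p) ≤ K ^ (1 / (p * ((a : ℝ) + 1))) * J ^ ((a : ℝ) / (a + 1)) := by
    have h1 : S = S ^ ((p - 1) / p) * S ^ (1 / p) := by
      rw [← Real.rpow_add h]
      have : (p - 1) / p + 1 / p = 1 := by field_simp; ring
      rw [this, Real.rpow_one]
    have h2 : 0 < S ^ ((p - 1) / p) := Real.rpow_pos_of_pos h _
    refine le_of_mul_le_mul_left ?_ h2
    rw [← h1]; exact hS3
  have h5 := Real.rpow_le_rpow (by positivity) hS4 hp0.le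
  rw [← Real.rpow_mul hS0, Real.mul_rpow (by positivity) (by positivity), ← Real.rpow_mul hK0,
    ← Real.rpow_mul hJ0, one_div_mul_cancel hp0.ne', Real.rpow_one] at h5
  convert h5 using 3
  · field_simp
  · ring

end Bipartite

/-! ### The edge-product bound for list colorings of triangle-free graphs -/

section ListColoring

open scoped Classical

variable {V α : Type*} [Fintype V] [DecidableEq α]

/-- The number of proper colorings of `G` from the lists `L`. -/
noncomputable def listCount (G : SimpleGraph V) (L : V → Finset α) : ℝ :=
  #{x ∈ Fintype.piFinset L | ∀ u v, G.Adj u v → x u ≠ x v}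

/-- The lists that remain once `w` has received the color `c`. -/
noncomputable def condList (G : SimpleGraph V) (L : V → Finset α) (w : V) (c : α) :
    V → Finset α :=
  fun v => if v = w then {c} else if G.Adj w v then (L v).erase c else L v

/-- Condition on the color of `w`. The vertex is kept as an isolated one with a singleton list, so
the vertex type never changes during the induction. -/
theorem listCount_eq_sum (G : SimpleGraph V) (L : V → Finset α) (w : V) :
    listCount G L = ∑ c ∈ L w, listCount (G.deleteIncidenceSet w) (condList G L w c) := by
  unfold listCount
  rw [card_eq_sum_card_fiberwise (f := fun x => x w) (t := L w)
    (fun x hx => by simp at hx; exact hx.1 w)]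
  push_cast
  refine sum_congr rfl fun c hc => ?_
  congr 2
  ext x
  simp only [mem_filter, Fintype.mem_piFinset, SimpleGraph.deleteIncidenceSet_adj, condList]
  constructor
  · rintro ⟨⟨h1, h2⟩, h3⟩
    refine ⟨fun v => ?_, fun u v h => h2 u v h.1⟩
    split_ifs with h4 h5
    · subst h4; simp [h3]
    · rw [mem_erase]; exact ⟨fun h => h2 w v h5 (h3.trans h.symm), h1 v⟩
    · exact h1 v
  · rintro ⟨h1, h2⟩
    have h3 : x w = c := by simpa using h1 w
    have h4 : ∀ v, G.Adj w v → x v ≠ c := by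
      intro v hv
      have := h1 v
      rw [if_neg hv.ne', if_pos hv, mem_erase] at this
      exact this.1
    refine ⟨⟨fun v => ?_, fun u v h => ?_⟩, h3⟩
    · have := h1 v
      split_ifs at this with h5 h6
      · subst h5; rw [h3]; exact hc
      · exact (mem_erase.1 this).2
      · exact this
    · by_cases hu : u = w
      · subst hu; rw [h3]; exact (h4 v h).symm
      · by_cases hv : v = w
        · subst hv; rw [h3]; exact h4 u h.symm
        · exact h2 u v ⟨h, hu, hv⟩

theorem neighborFinset_deleteIncidenceSet (G : SimpleGraph V) {w u : V} (h : u ≠ w) :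
    (G.deleteIncidenceSet w).neighborFinset u = (G.neighborFinset u).erase w := by
  ext v
  simp only [SimpleGraph.mem_neighborFinset, SimpleGraph.deleteIncidenceSet_adj, mem_erase]
  tauto

theorem degree_deleteIncidenceSet_self (G : SimpleGraph V) (w : V) :
    (G.deleteIncidenceSet w).degree w = 0 := by
  rw [← SimpleGraph.card_neighborFinset_eq_degree, card_eq_zero]
  ext v
  simp [SimpleGraph.deleteIncidenceSet_adj]

theorem degree_deleteIncidenceSet_of_adj (G : SimpleGraph V) {w u : V} (h : G.Adj w u) :
    (G.deleteIncidenceSet w).degree u = G.degree u - 1 := by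
  rw [← SimpleGraph.card_neighborFinset_eq_degree, neighborFinset_deleteIncidenceSet G h.ne',
    card_erase_of_mem (by simpa using h.symm), SimpleGraph.card_neighborFinset_eq_degree]

theorem degree_deleteIncidenceSet_of_not_adj (G : SimpleGraph V) {w u : V} (h : ¬ G.Adj w u)
    (hne : u ≠ w) : (G.deleteIncidenceSet w).degree u = G.degree u := by
  rw [← SimpleGraph.card_neighborFinset_eq_degree, neighborFinset_deleteIncidenceSet G hne,
    erase_eq_of_notMem (by simpa using fun h' => h h'.symm),
    SimpleGraph.card_neighborFinset_eq_degree]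

/-- The square root of the factor of an edge in `edgeBound`. -/
noncomputable def edgeFactor (G : SimpleGraph V) (L : V → Finset α) (u v : V) : ℝ :=
  bipCount (G.degree u) (G.degree v) (L u) (L v) ^ (1 / (2 * (G.degree u : ℝ) * G.degree v))

/-- The product over all edges `uv` of the number of list colorings of `K_{d(u), d(v)}` to the
power `1 / (d(u) d(v))`, times the list sizes of the isolated vertices. -/
noncomputable def edgeBound (G : SimpleGraph V) (L : V → Finset α) : ℝ :=
  (∏ u, if G.degree u = 0 then (#(L u) : ℝ) else 1) *
    ∏ u, ∏ v, if G.Adj u v then edgeFactor G L u v else 1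

theorem edgeFactor_nonneg (G : SimpleGraph V) (L : V → Finset α) (u v : V) :
    0 ≤ edgeFactor G L u v := Real.rpow_nonneg (bipCount_nonneg _ _ _ _) _

theorem edgeFactor_comm (G : SimpleGraph V) (L : V → Finset α) (u v : V) :
    edgeFactor G L u v = edgeFactor G L v u := by
  unfold edgeFactor
  rw [bipCount_comm]
  congr 1
  ring

/-- The products run over ordered pairs, so each edge occurs twice and its true contribution is this
square. -/
theorem edgeFactor_sq (G : SimpleGraph V) (L : V → Finset α) (u v : V) :
    edgeFactor G L u v ^ 2 = bipCount (G.degree u) (G.degree v) (L u) (L v) ^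
      (1 / ((G.degree u : ℝ) * G.degree v)) := by
  unfold edgeFactor
  rw [← Real.rpow_natCast, ← Real.rpow_mul (bipCount_nonneg _ _ _ _)]
  congr 1
  by_cases hu : (G.degree u : ℝ) = 0
  · simp [hu]
  by_cases hv : (G.degree v : ℝ) = 0
  · simp [hv]
  push_cast
  field_simp

/-- The part of `edgeBound` for the graph without `w` that depends on the neighbor `u` of `w`. -/
noncomputable def condFactor (G : SimpleGraph V) (L : V → Finset α) (w u : V) (c : α) : ℝ :=
  (if G.degree u = 1 then (#((L u).erase c) : ℝ) else 1) *
    ∏ v ∈ (G.neighborFinset u).erase w,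
      bipCount (G.degree u - 1) (G.degree v) ((L u).erase c) (L v) ^
        (1 / (((G.degree u - 1 : ℕ) : ℝ) * G.degree v))

/-- The part of `edgeBound` that depends on the neighbor `u` of `w`. -/
noncomputable def starFactor (G : SimpleGraph V) (L : V → Finset α) (w u : V) : ℝ :=
  bipCount (G.degree u) (G.degree w) (L u) (L w) ^ (1 / ((G.degree u : ℝ) * G.degree w)) *
    ∏ v ∈ (G.neighborFinset u).erase w,
      bipCount (G.degree u) (G.degree v) (L u) (L v) ^ (1 / ((G.degree u : ℝ) * G.degree v))

theorem condFactor_nonneg (G : SimpleGraph V) (L : V → Finset α) (w u : V) (c : α) :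
    0 ≤ condFactor G L w u c :=
  mul_nonneg (by split_ifs <;> positivity)
    (prod_nonneg fun _ _ => Real.rpow_nonneg (bipCount_nonneg _ _ _ _) _)

theorem starFactor_nonneg (G : SimpleGraph V) (L : V → Finset α) (w u : V) :
    0 ≤ starFactor G L w u :=
  mul_nonneg (Real.rpow_nonneg (bipCount_nonneg _ _ _ _) _)
    (prod_nonneg fun _ _ => Real.rpow_nonneg (bipCount_nonneg _ _ _ _) _)

/-- Supplies the hypothesis of Hölder over `N(w)`. It comes from a second Hölder, over the `d(u) -
1` neighbors of `u` other than `w`, each treated by the local inequality. -/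
theorem sum_condFactor_pow_le (G : SimpleGraph V) (L : V → Finset α) {w u : V} (hu : G.Adj w u)
    (hmax : ∀ v, G.degree v ≤ G.degree w) :
    ∑ c ∈ L w, condFactor G L w u c ^ G.degree w ≤ starFactor G L w u ^ G.degree w := by
  have hw : 0 < G.degree w := (G.degree_pos_iff_exists_adj w).2 ⟨u, hu⟩
  have hwr : (G.degree w : ℝ) ≠ 0 := by positivity
  have hcard : #((G.neighborFinset u).erase w) = G.degree u - 1 := by
    rw [card_erase_of_mem (by simpa using hu.symm), SimpleGraph.card_neighborFinset_eq_degree]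
  have hu0 : 0 < G.degree u := (G.degree_pos_iff_exists_adj u).2 ⟨w, hu.symm⟩
  obtain ⟨a, ha⟩ : ∃ a, G.degree u = a + 1 := ⟨G.degree u - 1, by omega⟩
  rw [ha, Nat.add_sub_cancel] at hcard
  -- If `u` is a pendant vertex it becomes isolated, and both sides count colorings of a star.
  rcases Nat.eq_zero_or_pos a with h0 | h0
  · subst h0
    have he : (G.neighborFinset u).erase w = ∅ := card_eq_zero.1 hcard
    simp only [condFactor, starFactor, he, ha, prod_empty]
    simp only [zero_add, if_true, mul_one]
    rw [Nat.cast_one, one_mul, one_div, Real.rpow_inv_natCast_pow (bipCount_nonneg _ _ _ _) hw.ne',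
      bipCount]
    refine le_of_eq (sum_nbij' (fun c _ => c) (fun y => y 0) ?_ ?_ ?_ ?_ ?_)
    · intro c hc; simpa using hc
    · intro y hy; simpa using hy
    · intro c hc; rfl
    · intro y hy; ext i; rw [Subsingleton.elim i 0]
    · intro c hc
      congr 3
      ext z
      simp [mem_avoid, and_comm]
  · have har : (a : ℝ) ≠ 0 := by positivity
    set U := (G.neighborFinset u).erase w with hU
    have hUne : U.Nonempty := card_pos.1 (by omega)
    have hpu : ∀ c, condFactor G L w u c ^ G.degree w = ∏ v ∈ U,
        bipCount a (G.degree v) ((L u).erase c) (L v) ^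
          ((G.degree w : ℝ) / (a * G.degree v)) := by
      intro c
      simp only [condFactor, ha]
      rw [if_neg (by omega), one_mul, ← prod_pow]
      refine prod_congr rfl fun v _ => ?_
      rw [← Real.rpow_natCast, ← Real.rpow_mul (bipCount_nonneg _ _ _ _)]
      congr 1
      simp
      ring
    simp_rw [hpu]
    set K := bipCount (a + 1) (G.degree w) (L u) (L w) with hK
    have hK0 : 0 ≤ K := bipCount_nonneg _ _ _ _
    have hJ0 : ∀ v, 0 ≤ bipCount (a + 1) (G.degree v) (L u) (L v) :=
      fun v => bipCount_nonneg _ _ _ _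
    -- `Ψ v` is the `a`-th root of the right side of the local inequality; over the `a` vertices `v`
    -- the powers of `K` combine into the factor of the edge `uw`.
    have key := (sum_prod_le_prod_of_sum_pow_le hUne (C := L w)
      (F := fun v c => bipCount a (G.degree v) ((L u).erase c) (L v) ^
          ((G.degree w : ℝ) / (a * G.degree v)))
      (Ψ := fun v => (K ^ (1 / ((a : ℝ) + 1)) * bipCount (a + 1) (G.degree v) (L u) (L v) ^
        ((G.degree w : ℝ) / G.degree v * (a / (a + 1)))) ^ (1 / (a : ℝ)))
      (fun v _ c _ => Real.rpow_nonneg (bipCount_nonneg _ _ _ _) _)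
      (fun v _ => Real.rpow_nonneg (mul_nonneg (Real.rpow_nonneg hK0 _)
        (Real.rpow_nonneg (hJ0 _) _)) _) ?_).1
    · refine key.trans_eq ?_
      simp only [starFactor, ha, mul_pow]
      rw [← prod_pow]
      have h1 : ∀ v ∈ U, (K ^ (1 / ((a : ℝ) + 1)) * bipCount (a + 1) (G.degree v) (L u) (L v) ^
        ((G.degree w : ℝ) / G.degree v * (a / (a + 1)))) ^ (1 / (a : ℝ)) =
        K ^ (1 / (((a : ℝ) + 1) * a)) * (bipCount (a + 1) (G.degree v) (L u) (L v) ^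
          (1 / (((a : ℝ) + 1) * G.degree v))) ^ G.degree w := by
        intro v _
        rw [Real.mul_rpow (Real.rpow_nonneg hK0 _) (Real.rpow_nonneg (hJ0 _) _),
          ← Real.rpow_mul hK0, ← Real.rpow_mul (hJ0 _), ← Real.rpow_natCast,
          ← Real.rpow_mul (hJ0 _)]
        congr 2
        · field_simp
        · by_cases hv : (G.degree v : ℝ) = 0
          · simp [hv]
          · field_simp
      rw [prod_congr rfl h1, prod_mul_distrib, prod_const, hcard]
      push_cast
      congr 1
      rw [← Real.rpow_natCast, ← Real.rpow_mul hK0, ← Real.rpow_natCast, ← Real.rpow_mul hK0]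
      congr 1
      field_simp
    · intro v hv
      have hv0 : 0 < G.degree v := by
        rw [hU, mem_erase, SimpleGraph.mem_neighborFinset] at hv
        exact (G.degree_pos_iff_exists_adj v).2 ⟨u, hv.2.symm⟩
      rw [hcard, one_div (a : ℝ), Real.rpow_inv_natCast_pow (mul_nonneg (Real.rpow_nonneg hK0 _)
        (Real.rpow_nonneg (hJ0 _) _)) h0.ne']
      refine le_trans (le_of_eq (sum_congr rfl fun c _ => ?_))
        (sum_rpow_bipCount_erase_le h0 hv0 (hmax v) (L u) (L v) (L w))
      rw [← Real.rpow_natCast, ← Real.rpow_mul (bipCount_nonneg _ _ _ _)]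
      congr 1
      field_simp

/-- The part of `edgeBound` unaffected by removing `w`. -/
noncomputable def farFactor (G : SimpleGraph V) (L : V → Finset α) (w : V) : ℝ :=
  (∏ u, if G.degree u = 0 then (#(L u) : ℝ) else 1) *
    ∏ u, ∏ v, if G.Adj u v ∧ u ≠ w ∧ v ≠ w ∧ ¬ G.Adj w u ∧ ¬ G.Adj w v then
      edgeFactor G L u v else 1

theorem farFactor_nonneg (G : SimpleGraph V) (L : V → Finset α) (w : V) :
    0 ≤ farFactor G L w :=
  mul_nonneg (prod_nonneg fun _ _ => by split_ifs <;> positivity)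
    (prod_nonneg fun _ _ => prod_nonneg fun _ _ => by
      split_ifs <;> first | positivity | exact edgeFactor_nonneg _ _ _ _)

/-- Edges near `w` are recorded in one chosen orientation only; symmetrizing over ordered pairs
turns their half-factors into full ones. -/
theorem prod_prod_mul_swap (R S W : V → V → ℝ) :
    ∏ u, ∏ v, R u v * (S u v * S v u) * (W u v * W v u) =
      (∏ u, ∏ v, R u v) * (∏ u, ∏ v, S u v ^ 2) * ∏ u, ∏ v, W u v ^ 2 := by
  simp_rw [sq, prod_mul_distrib]
  rw [prod_comm (f := fun u v => S v u), prod_comm (f := fun u v => W v u)]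

theorem prod_prod_second (G : SimpleGraph V) (w : V) (s : V → V → ℝ) :
    ∏ u, ∏ v, (if G.Adj w u ∧ G.Adj u v ∧ v ≠ w then s u v else 1) =
      ∏ u ∈ G.neighborFinset w, ∏ v ∈ (G.neighborFinset u).erase w, s u v := by
  rw [SimpleGraph.neighborFinset_eq_filter, prod_filter]
  refine prod_congr rfl fun u _ => ?_
  split_ifs with h
  · rw [← prod_filter]
    refine prod_congr ?_ fun _ _ => rfl
    ext v; simp [h, and_comm]
  · simp [h]

/-- No two neighbors of `w` are adjacent, so each edge that meets `w` or `N(w)` belongs to exactly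
one neighbor `u` of `w`, and the bound factors over `N(w)`. -/
theorem edgeBound_eq (G : SimpleGraph V) (L : V → Finset α)
    (hT : ∀ a b c, G.Adj a b → G.Adj b c → ¬ G.Adj a c) (w : V) :
    edgeBound G L = farFactor G L w * ∏ u ∈ G.neighborFinset w, starFactor G L w u := by
  have h1 : ∀ u v, (if G.Adj u v then edgeFactor G L u v else 1) =
      (if G.Adj u v ∧ u ≠ w ∧ v ≠ w ∧ ¬ G.Adj w u ∧ ¬ G.Adj w v then
        edgeFactor G L u v else 1) *
      ((if G.Adj w u ∧ G.Adj u v ∧ v ≠ w then edgeFactor G L u v else 1) *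
        (if G.Adj w v ∧ G.Adj v u ∧ u ≠ w then edgeFactor G L v u else 1)) *
      ((if u = w ∧ G.Adj w v then edgeFactor G L u v else 1) *
        (if v = w ∧ G.Adj w u then edgeFactor G L v u else 1)) := by
    intro u v
    by_cases h : G.Adj u v
    · have h' := h.symm
      by_cases hu : u = w
      · subst hu
        simp [h]
      · by_cases hv : v = w
        · subst hv
          simp [h, h', edgeFactor_comm G L u v]
        · have := edgeFactor_comm G L u v
          by_cases h2 : G.Adj w u
          · have h3 := hT w u v h2 h
            simp [h, hu, hv, h2, h3]
          · by_cases h3 : G.Adj w v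
            · simp [h, hu, hv, h2, h3, this, h']
            · simp [h, hu, hv, h2, h3]
    · have h' : ¬ G.Adj v u := fun h' => h h'.symm
      have h2 : ¬ (u = w ∧ G.Adj w v) := by rintro ⟨rfl, h2⟩; exact h h2
      have h3 : ¬ (v = w ∧ G.Adj w u) := by rintro ⟨rfl, h2⟩; exact h' h2
      simp [h, h', h2, h3]
  have h2 : ∀ u v, (if G.Adj w u ∧ G.Adj u v ∧ v ≠ w then edgeFactor G L u v else 1) ^ 2 =
      if G.Adj w u ∧ G.Adj u v ∧ v ≠ w then edgeFactor G L u v ^ 2 else 1 := by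
    intro u v; split_ifs <;> simp
  have h3 : ∏ u, ∏ v, (if u = w ∧ G.Adj w v then edgeFactor G L u v else 1) ^ 2 =
      ∏ v ∈ G.neighborFinset w, edgeFactor G L v w ^ 2 := by
    rw [prod_eq_single w, SimpleGraph.neighborFinset_eq_filter, prod_filter]
    · refine prod_congr rfl fun v _ => ?_
      rw [edgeFactor_comm]
      split_ifs <;> simp_all
    · intro u _ hu; simp [hu]
    · simp
  simp only [edgeBound, farFactor, h1]
  rw [prod_prod_mul_swap]
  simp only [h2]
  rw [h3, prod_prod_second, mul_assoc, mul_assoc, ← prod_mul_distrib]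
  congr 3
  ext u
  rw [starFactor, mul_comm, edgeFactor_sq]
  simp only [edgeFactor_sq]

/-- Deleting `w` changes degrees and lists only at `w` and `N(w)`. By triangle-freeness the far end
`v` of an edge at `u ∈ N(w)` keeps its degree and list, so the same factorization applies. -/
theorem edgeBound_deleteIncidenceSet_eq (G : SimpleGraph V) (L : V → Finset α)
    (hT : ∀ a b c, G.Adj a b → G.Adj b c → ¬ G.Adj a c) {w : V} (hw : 0 < G.degree w) (c : α) :
    edgeBound (G.deleteIncidenceSet w) (condList G L w c) =
      farFactor G L w * ∏ u ∈ G.neighborFinset w, condFactor G L w u c := by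
  have hLn : ∀ u, G.Adj w u → condList G L w c u = (L u).erase c := by
    intro u hu; rw [condList, if_neg hu.ne', if_pos hu]
  have hLf : ∀ u, ¬ G.Adj w u → u ≠ w → condList G L w c u = L u := by
    intro u hu hne; rw [condList, if_neg hne, if_neg hu]
  have hLw : condList G L w c w = {c} := if_pos rfl
  obtain ⟨G', hG'⟩ : ∃ G', G' = G.deleteIncidenceSet w := ⟨_, rfl⟩
  have hdw : G'.degree w = 0 := by subst hG'; convert degree_deleteIncidenceSet_self G w
  have hdn : ∀ u, G.Adj w u → G'.degree u = G.degree u - 1 := fun u hu => by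
    subst hG'; convert degree_deleteIncidenceSet_of_adj G hu
  have hdf : ∀ u, ¬ G.Adj w u → u ≠ w → G'.degree u = G.degree u := fun u hu hne => by
    subst hG'; convert degree_deleteIncidenceSet_of_not_adj G hu hne
  have hadj : ∀ u v, G'.Adj u v ↔ G.Adj u v ∧ u ≠ w ∧ v ≠ w := fun u v => by
    rw [hG', SimpleGraph.deleteIncidenceSet_adj]
  rw [← hG']
  generalize condList G L w c = L' at *
  have h1 : ∀ u v, (if G'.Adj u v then edgeFactor G' L' u v else 1) =
      (if G.Adj u v ∧ u ≠ w ∧ v ≠ w ∧ ¬ G.Adj w u ∧ ¬ G.Adj w v then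
        edgeFactor G L u v else 1) *
      ((if G.Adj w u ∧ G.Adj u v ∧ v ≠ w then edgeFactor G' L' u v else 1) *
        (if G.Adj w v ∧ G.Adj v u ∧ u ≠ w then edgeFactor G' L' v u else 1)) * (1 * 1) := by
    intro u v
    by_cases h : G.Adj u v
    · have h' := h.symm
      by_cases hu : u = w
      · subst hu
        simp [hadj]
      · by_cases hv : v = w
        · subst hv
          simp [hadj]
        · have := edgeFactor_comm G' L' u v
          by_cases h2 : G.Adj w u
          · have h3 := hT w u v h2 h
            simp [h, hu, hv, h2, h3, hadj]
          · by_cases h3 : G.Adj w v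
            · simp [h, hu, hv, h2, h3, this, h']
              simp [h, hu, hv, hadj]
            · have : edgeFactor G' L' u v = edgeFactor G L u v := by
                unfold edgeFactor
                rw [hdf u h2 hu, hdf v h3 hv, hLf u h2 hu, hLf v h3 hv]
              simp [h, hu, hv, h2, h3, this]
              simp [h, hu, hv, hadj]
    · have h' : ¬ G.Adj v u := fun h' => h h'.symm
      simp [h, h', hadj]
  have h2 : ∀ u v, (if G.Adj w u ∧ G.Adj u v ∧ v ≠ w then edgeFactor G' L' u v else 1) ^ 2 =
      if G.Adj w u ∧ G.Adj u v ∧ v ≠ w then edgeFactor G' L' u v ^ 2 else 1 := by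
    intro u v; split_ifs <;> simp
  have h3 : ∏ u, (if G'.degree u = 0 then (#(L' u) : ℝ) else 1) =
      (∏ u, (if G.degree u = 0 then (#(L u) : ℝ) else 1)) *
      ∏ u ∈ G.neighborFinset w, if G.degree u = 1 then (#((L u).erase c) : ℝ) else 1 := by
    rw [SimpleGraph.neighborFinset_eq_filter, prod_filter, ← prod_mul_distrib]
    refine prod_congr rfl fun u _ => ?_
    by_cases hu : u = w
    · subst hu
      rw [if_pos hdw, if_neg hw.ne', hLw]
      simp
    · by_cases h : G.Adj w u
      · have h0 : 0 < G.degree u := (G.degree_pos_iff_exists_adj u).2 ⟨w, h.symm⟩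
        rw [if_pos h, hdn u h, hLn u h, if_neg h0.ne', one_mul]
        refine if_congr ?_ rfl rfl
        omega
      · rw [if_neg h, hdf u h hu, hLf u h hu, mul_one]
  simp only [edgeBound, farFactor, h1]
  rw [prod_prod_mul_swap _ _ (fun _ _ => 1)]
  simp only [h2]
  rw [h3, prod_prod_second]
  simp only [one_pow, prod_const_one, mul_one, condFactor, prod_mul_distrib]
  have h4 : ∀ u ∈ G.neighborFinset w, ∏ v ∈ (G.neighborFinset u).erase w,
      edgeFactor G' L' u v ^ 2 = ∏ v ∈ (G.neighborFinset u).erase w,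
      bipCount (G.degree u - 1) (G.degree v) ((L u).erase c) (L v) ^
        (1 / (((G.degree u - 1 : ℕ) : ℝ) * G.degree v)) := by
    intro u hu
    rw [SimpleGraph.mem_neighborFinset] at hu
    refine prod_congr rfl fun v hv => ?_
    rw [mem_erase, SimpleGraph.mem_neighborFinset] at hv
    have hvw := hT w u v hu hv.2
    rw [edgeFactor_sq, hdn u hu, hdf v hvw hv.1, hLn u hu, hLf v hvw hv.1]
  rw [prod_congr rfl h4]
  ring

/-- Hölder over `N(w)`, whose size is the exponent `d(w)`. The strict form asks for two neighbors of
`w` that rank two colors oppositely. -/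
theorem sum_edgeBound_deleteIncidenceSet_le (G : SimpleGraph V) (L : V → Finset α)
    (hT : ∀ a b c, G.Adj a b → G.Adj b c → ¬ G.Adj a c) {w : V} (hw : 0 < G.degree w)
    (hmax : ∀ v, G.degree v ≤ G.degree w) :
    ∑ c ∈ L w, edgeBound (G.deleteIncidenceSet w) (condList G L w c) ≤ edgeBound G L ∧
    (0 < edgeBound G L → (∃ u v, G.Adj w u ∧ G.Adj w v ∧ ∃ c ∈ L w, ∃ d ∈ L w,
        condFactor G L w u d < condFactor G L w u c ∧
        condFactor G L w v c ≤ condFactor G L w v d) →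
      ∑ c ∈ L w, edgeBound (G.deleteIncidenceSet w) (condList G L w c) < edgeBound G L) := by
  simp only [edgeBound_deleteIncidenceSet_eq G L hT hw]
  rw [edgeBound_eq G L hT w, ← mul_sum]
  have hne : (G.neighborFinset w).Nonempty := by
    rwa [← card_pos, SimpleGraph.card_neighborFinset_eq_degree]
  obtain ⟨h1, h2⟩ := sum_prod_le_prod_of_sum_pow_le hne (C := L w) (F := condFactor G L w)
    (Ψ := starFactor G L w) (fun u _ c _ => condFactor_nonneg G L w u c)
    (fun u _ => starFactor_nonneg G L w u) (fun u hu => by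
      rw [SimpleGraph.card_neighborFinset_eq_degree]
      exact sum_condFactor_pow_le G L (by simpa using hu) hmax)
  refine ⟨mul_le_mul_of_nonneg_left h1 (farFactor_nonneg G L w), fun hpos h => ?_⟩
  have hC := pos_of_mul_pos_left hpos (prod_nonneg fun u _ => starFactor_nonneg G L w u)
  have hP := pos_of_mul_pos_right hpos (farFactor_nonneg G L w)
  refine mul_lt_mul_of_pos_left (h2 (fun u hu => ?_) ?_) hC
  · refine lt_of_le_of_ne (starFactor_nonneg G L w u) fun h0 => hP.ne' ?_
    exact prod_eq_zero hu h0.symm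
  · obtain ⟨u, v, hu, hv, h⟩ := h
    exact ⟨u, by simpa using hu, v, by simpa using hv, h⟩

theorem triangleFree_deleteIncidenceSet {V : Type*} {G : SimpleGraph V}
    (hT : ∀ a b c, G.Adj a b → G.Adj b c → ¬ G.Adj a c) (w : V) :
    ∀ a b c, (G.deleteIncidenceSet w).Adj a b → (G.deleteIncidenceSet w).Adj b c →
      ¬ (G.deleteIncidenceSet w).Adj a c := by
  simp only [SimpleGraph.deleteIncidenceSet_adj]
  exact fun a b c h1 h2 h3 => hT a b c h1.1 h2.1 h3.1

theorem deleteIncidenceSet_lt {G : SimpleGraph V} {w : V} (hw : 0 < G.degree w) :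
    G.deleteIncidenceSet w < G := by
  refine lt_of_le_of_ne (G.deleteIncidenceSet_le w) fun h => ?_
  obtain ⟨u, hu⟩ := (G.degree_pos_iff_exists_adj w).1 hw
  rw [← h, SimpleGraph.deleteIncidenceSet_adj] at hu
  exact hu.2.1 rfl

theorem listCount_le_edgeBound (G : SimpleGraph V) (L : V → Finset α)
    (hT : ∀ a b c, G.Adj a b → G.Adj b c → ¬ G.Adj a c) : listCount G L ≤ edgeBound G L := by
  induction G using WellFoundedLT.induction generalizing L with
  | ind G ih =>
    by_cases h : ∃ v, 0 < G.degree v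
    · obtain ⟨v, hv⟩ := h
      obtain ⟨w, -, hw⟩ := exists_max_image univ (fun v => G.degree v) ⟨v, mem_univ v⟩
      have hmax : ∀ v, G.degree v ≤ G.degree w := fun v => hw v (mem_univ v)
      have hpos : 0 < G.degree w := hv.trans_le (hmax v)
      rw [listCount_eq_sum G L w]
      exact (sum_le_sum fun c _ => ih _ (deleteIncidenceSet_lt hpos) _
        (triangleFree_deleteIncidenceSet hT w)).trans
        (sum_edgeBound_deleteIncidenceSet_le G L hT hpos hmax).1
    · push Not at h
      have h0 : ∀ v, G.degree v = 0 := fun v => Nat.le_zero.1 (h v)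
      have hadj : ∀ u v, ¬ G.Adj u v := fun u v huv =>
        ((G.degree_pos_iff_exists_adj u).2 ⟨v, huv⟩).ne' (h0 u)
      simp [listCount, edgeBound, h0, hadj]

end ListColoring

/-! ### Comparing `K_{a,b}` densities by power means -/

section Jensen

variable {α : Type*} [Fintype α] [DecidableEq α]

variable (α) in
/-- The homomorphism density of `K_{a,b}` in the complete graph on `α`. -/
noncomputable def bipDensity (a b : ℕ) : ℝ :=
  bipCount a b (univ : Finset α) univ / (Fintype.card α : ℝ) ^ (a + b)

theorem bipDensity_nonneg (a b : ℕ) : 0 ≤ bipDensity α a b :=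
  div_nonneg (bipCount_nonneg _ _ _ _) (by positivity)

theorem bipDensity_comm (a b : ℕ) : bipDensity α a b = bipDensity α b a := by
  rw [bipDensity, bipCount_comm, add_comm, bipDensity]

/-- The density is the `b`-th moment of the fraction of colors avoiding a uniform `a`-tuple, so this
is monotonicity of power means. -/
theorem bipDensity_le_rpow [Nonempty α] {a b c : ℕ} (hb : 1 ≤ b) (hc : b ≤ c) :
    bipDensity α a b ≤ bipDensity α a c ^ ((b : ℝ) / c) := by
  have hq : (0 : ℝ) < Fintype.card α := by exact_mod_cast Fintype.card_pos
  have hb0 : (0 : ℝ) < b := by exact_mod_cast hb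
  have hc0 : (0 : ℝ) < c := by exact_mod_cast hb.trans hc
  have hY : (#(Fintype.piFinset fun _ : Fin a => (univ : Finset α)) : ℝ) =
      (Fintype.card α : ℝ) ^ a := by
    rw [Fintype.card_piFinset_const]; push_cast; rfl
  have h := Real.rpow_arith_mean_le_arith_mean_rpow
    (Fintype.piFinset fun _ : Fin a => (univ : Finset α))
    (fun _ => 1 / (Fintype.card α : ℝ) ^ a)
    (fun y => ((#(avoid univ y) : ℝ) / Fintype.card α) ^ b) (fun _ _ => by positivity)
    (by rw [sum_const, nsmul_eq_mul, hY]; field_simp) (fun _ _ => by positivity)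
    (p := (c : ℝ) / b) ((one_le_div hb0).2 (by exact_mod_cast hc))
  have h1 : ∑ y ∈ Fintype.piFinset (fun _ : Fin a => (univ : Finset α)),
      1 / (Fintype.card α : ℝ) ^ a * ((#(avoid univ y) : ℝ) / Fintype.card α) ^ b =
      bipDensity α a b := by
    simp only [bipDensity, bipCount, sum_div]
    refine sum_congr rfl fun y _ => ?_
    rw [div_pow, pow_add]; field_simp
  have h2 : ∑ y ∈ Fintype.piFinset (fun _ : Fin a => (univ : Finset α)),
      1 / (Fintype.card α : ℝ) ^ a *
        (((#(avoid univ y) : ℝ) / Fintype.card α) ^ b) ^ ((c : ℝ) / b) =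
      bipDensity α a c := by
    simp only [bipDensity, bipCount, sum_div]
    refine sum_congr rfl fun y _ => ?_
    rw [← Real.rpow_natCast _ b, ← Real.rpow_mul (by positivity), mul_div_cancel₀ _ hb0.ne',
      Real.rpow_natCast, div_pow, pow_add]; field_simp
  rw [h1, h2] at h
  have h3 := Real.rpow_le_rpow (Real.rpow_nonneg (bipDensity_nonneg _ _) _) h
    (by positivity : (0 : ℝ) ≤ (b : ℝ) / c)
  rwa [← Real.rpow_mul (bipDensity_nonneg _ _), div_mul_div_cancel₀ hb0.ne', div_self hc0.ne',
    Real.rpow_one] at h3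

variable (α) in
/-- The homomorphism density of `K_{3,3}` in the complete graph on `α`, per edge. -/
noncomputable def edgeDensity : ℝ := bipDensity α 3 3 ^ ((1 : ℝ) / 9)

theorem edgeDensity_pos (hq : 2 ≤ Fintype.card α) : 0 < edgeDensity α := by
  obtain ⟨x, y, hxy⟩ := Fintype.one_lt_card_iff.1 hq
  refine Real.rpow_pos_of_pos (div_pos (bipCount_pos (mem_univ x) (mem_univ y) hxy) ?_) _
  exact pow_pos (by exact_mod_cast (by omega)) _

/-- Enlarge each side to 3 in turn by the power mean inequality. -/
theorem bipDensity_le [Nonempty α] {a b : ℕ} (ha : 1 ≤ a) (ha' : a ≤ 3) (hb : 1 ≤ b)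
    (hb' : b ≤ 3) : bipDensity α a b ≤ edgeDensity α ^ (a * b) := by
  have h1 := bipDensity_le_rpow (α := α) (a := a) hb hb'
  have h2 := bipDensity_le_rpow (α := α) (a := 3) ha ha'
  rw [bipDensity_comm 3 a] at h2
  refine h1.trans ((Real.rpow_le_rpow (bipDensity_nonneg _ _) h2 (by positivity)).trans_eq ?_)
  rw [edgeDensity, ← Real.rpow_natCast, ← Real.rpow_mul (bipDensity_nonneg _ _),
    ← Real.rpow_mul (bipDensity_nonneg _ _)]
  congr 1
  push_cast
  ring

/-- The case `K_{1,1}` of `bipDensity_le`; it lets the triangle step be compared with powers of `ρ`.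
-/
theorem card_sub_one_le_mul_edgeDensity [Nonempty α] :
    (Fintype.card α : ℝ) - 1 ≤ Fintype.card α * edgeDensity α := by
  have hq : (0 : ℝ) < Fintype.card α := by exact_mod_cast Fintype.card_pos
  have h := bipDensity_le (α := α) (a := 1) (b := 1) le_rfl (by norm_num) le_rfl (by norm_num)
  have h1 : bipCount 1 1 (univ : Finset α) univ =
      Fintype.card α * ((Fintype.card α : ℝ) - 1) := by
    have : ∀ y : Fin 1 → α, (#(avoid univ y) : ℝ) ^ 1 = (Fintype.card α : ℝ) - 1 := by
      intro y
      have : avoid univ y = univ.erase (y 0) := by ext z; simp [mem_avoid]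
      rw [this, card_erase_of_mem (mem_univ _), card_univ, pow_one,
        Nat.cast_sub Fintype.card_pos, Nat.cast_one]
    rw [bipCount, sum_congr rfl fun y _ => this y, sum_const, Fintype.card_piFinset_const]
    simp
  rw [bipDensity, h1, mul_one, pow_one, div_le_iff₀ (by positivity)] at h
  exact le_of_mul_le_mul_left (h.trans_eq (by ring)) hq

end Jensen

/-! ### From the edge product to a bound in vertices and edges -/

section TriangleFree

open scoped Classical

variable {V α : Type*} [Fintype V] [Fintype α] [DecidableEq α]

/-- The edge `uv` contributes at most `ρ * q ^ (1 / d(u)) * q ^ (1 / d(v))`. The `d(u)` edges at `u`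
together give one factor `q`, as does an isolated vertex. -/
theorem edgeBound_univ_le [Nonempty α] (G : SimpleGraph V) (hdeg : ∀ v, G.degree v ≤ 3) :
    edgeBound G (fun _ => (univ : Finset α)) ≤
      (Fintype.card α : ℝ) ^ Fintype.card V * edgeDensity α ^ #G.edgeFinset := by
  have hq : (0 : ℝ) < Fintype.card α := by exact_mod_cast Fintype.card_pos
  set q : ℝ := (Fintype.card α : ℝ) with hqd
  have hρ : 0 ≤ edgeDensity α := Real.rpow_nonneg (bipDensity_nonneg _ _) _
  set ρ := edgeDensity α with hρd
  have h1 : ∀ u v, (if G.Adj u v then edgeFactor G (fun _ => (univ : Finset α)) u v else 1) ≤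
      (if G.Adj u v then √ρ else 1) * ((if G.Adj u v then q ^ (1 / (2 * (G.degree u : ℝ))) else 1) *
        (if G.Adj v u then q ^ (1 / (2 * (G.degree v : ℝ))) else 1)) * (1 * 1) := by
    intro u v
    by_cases h : G.Adj u v
    · have hu : 0 < G.degree u := (G.degree_pos_iff_exists_adj u).2 ⟨v, h⟩
      have hv : 0 < G.degree v := (G.degree_pos_iff_exists_adj v).2 ⟨u, h.symm⟩
      have hu' : (0 : ℝ) < G.degree u := by exact_mod_cast hu
      have hv' : (0 : ℝ) < G.degree v := by exact_mod_cast hv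
      rw [if_pos h, if_pos h, if_pos h, if_pos h.symm, edgeFactor, mul_one, mul_one]
      have h2 := bipDensity_le (α := α) hu (hdeg u) hv (hdeg v)
      rw [bipDensity, div_le_iff₀ (by positivity)] at h2
      refine (Real.rpow_le_rpow (bipCount_nonneg _ _ _ _) h2 (by positivity)).trans_eq ?_
      rw [Real.mul_rpow (by positivity) (by positivity), ← Real.rpow_natCast,
        ← Real.rpow_mul hρ, ← Real.rpow_natCast, ← Real.rpow_mul hq.le, Real.sqrt_eq_rpow,
        ← Real.rpow_add hq]
      congr 2
      · push_cast; field_simp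
      · push_cast; field_simp; ring
    · have h' : ¬ G.Adj v u := fun h' => h h'.symm
      simp [h, h']
  have h2 : ∀ u v, (if G.Adj u v then q ^ (1 / (2 * (G.degree u : ℝ))) else 1) ^ 2 =
      if G.Adj u v then q ^ (1 / (G.degree u : ℝ)) else 1 := by
    intro u v
    split_ifs with h
    · have hu' : (0 : ℝ) < G.degree u := by
        exact_mod_cast (G.degree_pos_iff_exists_adj u).2 ⟨v, h⟩
      rw [← Real.rpow_natCast, ← Real.rpow_mul hq.le]
      congr 1; push_cast; field_simp
    · simp
  have h3 : ∀ (c : ℝ) u, ∏ v, (if G.Adj u v then c else 1) = c ^ G.degree u := by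
    intro c u
    rw [← prod_filter, prod_const, ← SimpleGraph.neighborFinset_eq_filter,
      SimpleGraph.card_neighborFinset_eq_degree]
  calc edgeBound G (fun _ => (univ : Finset α))
      ≤ (∏ u, if G.degree u = 0 then q else 1) * ∏ u, ∏ v, (if G.Adj u v then √ρ else 1) *
        ((if G.Adj u v then q ^ (1 / (2 * (G.degree u : ℝ))) else 1) *
        (if G.Adj v u then q ^ (1 / (2 * (G.degree v : ℝ))) else 1)) * (1 * 1) := by
        refine mul_le_mul_of_nonneg_left ?_ (prod_nonneg fun _ _ => by split_ifs <;> positivity)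
        refine prod_le_prod (fun u _ => prod_nonneg fun v _ => ?_) fun u _ =>
          prod_le_prod (fun v _ => ?_) fun v _ => h1 u v
        all_goals split_ifs <;> first | positivity | exact edgeFactor_nonneg _ _ _ _
    _ = q ^ Fintype.card V * ρ ^ #G.edgeFinset := by
        rw [prod_prod_mul_swap _ _ (fun _ _ => 1)]
        simp only [h2, h3, one_pow, prod_const_one, mul_one]
        rw [prod_pow_eq_pow_sum, SimpleGraph.sum_degrees_eq_twice_card_edges, pow_mul,
          Real.sq_sqrt hρ, mul_left_comm, ← prod_mul_distrib, mul_comm]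
        congr 1
        rw [← card_univ, ← prod_const]
        refine prod_congr rfl fun u _ => ?_
        by_cases hu : G.degree u = 0
        · simp [hu]
        · rw [if_neg hu, one_mul, one_div, Real.rpow_inv_natCast_pow hq.le hu]

end TriangleFree

/-! ### Coloring a triangle with at most one forbidden color per vertex -/

section Triangle

variable {α : Type*} [DecidableEq α]

theorem sum_distinct_triples (A B C : Finset α) :
    (∑ a ∈ A, ∑ b ∈ B, ∑ c ∈ C, if a ≠ b ∧ a ≠ c ∧ b ≠ c then (1 : ℤ) else 0) =
      #A * #B * #C - #(A ∩ B) * #C - #(A ∩ C) * #B - #(B ∩ C) * #A + 2 * #(A ∩ B ∩ C) := by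
  have h : ∀ a b c : α, (if a ≠ b ∧ a ≠ c ∧ b ≠ c then (1 : ℤ) else 0) =
      1 - (if a = b then 1 else 0) - (if a = c then 1 else 0) - (if b = c then 1 else 0) +
        2 * (if a = b then (if a = c then 1 else 0) else 0) := by
    intro a b c
    by_cases h1 : a = b
    · subst h1; by_cases h2 : a = c <;> simp [h2]
    · by_cases h2 : a = c
      · subst h2; simp [h1, Ne.symm h1]
      · by_cases h3 : b = c <;> simp [h1, h2, h3]
  simp_rw [h, sum_add_distrib, sum_sub_distrib, ← mul_sum]
  have e1 : ∑ a ∈ A, ∑ b ∈ B, ∑ c ∈ C, (if a = b then (1 : ℤ) else 0) = #(A ∩ B) * #C := by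
    simp [sum_ite_eq, mul_comm]
  have e2 : ∑ a ∈ A, ∑ b ∈ B, ∑ c ∈ C, (if a = c then (1 : ℤ) else 0) = #(A ∩ C) * #B := by
    simp [sum_ite_eq, mul_comm]
  have e3 : ∑ a ∈ A, ∑ b ∈ B, ∑ c ∈ C, (if b = c then (1 : ℤ) else 0) = #(B ∩ C) * #A := by
    simp [sum_ite_eq, mul_comm]
  have e4 : ∑ a ∈ A, ∑ b ∈ B, ∑ c ∈ C, (if a = b then (if a = c then (1 : ℤ) else 0) else 0) =
      #(A ∩ B ∩ C) := by
    have : ∀ a ∈ A, ∑ b ∈ B, ∑ c ∈ C, (if a = b then (if a = c then (1 : ℤ) else 0) else 0) =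
        if a ∈ B ∩ C then 1 else 0 := by
      intro a _
      by_cases h1 : a ∈ B <;> by_cases h2 : a ∈ C <;>
        simp [h1, h2]
    rw [sum_congr rfl this, sum_boole, filter_mem_eq_inter, inter_assoc]
  rw [e1, e2, e3, e4]
  simp
  ring

/-- `A`, `B`, `C` hold the colors forbidden at the triangle's vertices by outside neighbors. The `+
1` is the gap that makes the triangle case strict. -/
theorem sum_distinct_triples_compl_lt [Fintype α] (hq : 2 ≤ Fintype.card α) {A B C : Finset α}
    (hA : #A ≤ 1) (hB : #B ≤ 1) (hC : #C ≤ 1) :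
    (∑ a ∈ Aᶜ, ∑ b ∈ Bᶜ, ∑ c ∈ Cᶜ, if a ≠ b ∧ a ≠ c ∧ b ≠ c then (1 : ℤ) else 0) *
      (Fintype.card α : ℤ) ^ (#A + #B + #C) + 1 ≤
      ((Fintype.card α : ℤ) - 1) ^ (3 + (#A + #B + #C)) := by
  rcases hq.eq_or_lt with h2 | h3
  -- With two colors no triangle can be colored, and the right side is 1.
  · have : ∀ a b c : α, ¬ (a ≠ b ∧ a ≠ c ∧ b ≠ c) := by
      rintro a b c ⟨h4, h5, h6⟩
      have := card_le_univ ({a, b, c} : Finset α)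
      rw [card_eq_three.2 ⟨a, b, c, h4, h5, h6, rfl⟩] at this
      omega
    simp [this, ← h2]
  · rw [sum_distinct_triples]
    simp only [← compl_union]
    have hcard : ∀ S : Finset α, (#Sᶜ : ℤ) = Fintype.card α - #S := by
      intro S; rw [card_compl, Nat.cast_sub (card_le_univ S)]
    simp only [hcard]
    have u1 := card_union_add_card_inter A B
    have u2 := card_union_add_card_inter A C
    have u3 := card_union_add_card_inter B C
    have u4 := card_union_add_card_inter (A ∪ B) C
    have u5 : #((A ∪ B) ∩ C) ≤ #(A ∩ C) + #(B ∩ C) := by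
      rw [union_inter_distrib_right]; exact card_union_le _ _
    generalize #(A ∪ B ∪ C) = s at *
    generalize #((A ∪ B) ∩ C) = t at *
    generalize #(A ∪ B) = s1 at *
    generalize #(A ∪ C) = s2 at *
    generalize #(B ∪ C) = s3 at *
    generalize #(A ∩ B) = o1 at *
    generalize #(A ∩ C) = o2 at *
    generalize #(B ∩ C) = o3 at *
    generalize #A = f1 at *
    generalize #B = f2 at *
    generalize #C = f3 at *
    obtain ⟨r, hr⟩ : ∃ r, Fintype.card α = r + 3 := ⟨Fintype.card α - 3, by omega⟩
    rw [hr]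
    -- The count is largest when the forbidden sets are treated as pairwise disjoint: an overlap
    -- such as `o1` enters with coefficient at most `-(r + 1 - f3) ≤ 0`. With `q = r + 3` the
    -- remaining differences are polynomials in `r` with nonnegative coefficients.
    have key : ((r + 3 : ℕ) - f1 : ℤ) * ((r + 3 : ℕ) - f2) * ((r + 3 : ℕ) - f3) -
        ((r + 3 : ℕ) - s1) * ((r + 3 : ℕ) - f3) - ((r + 3 : ℕ) - s2) * ((r + 3 : ℕ) - f2) -
        ((r + 3 : ℕ) - s3) * ((r + 3 : ℕ) - f1) + 2 * ((r + 3 : ℕ) - s) ≤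
        ((r + 3 : ℕ) - f1 : ℤ) * ((r + 3 : ℕ) - f2) * ((r + 3 : ℕ) - f3) -
        ((r + 3 : ℕ) - f1 - f2) * ((r + 3 : ℕ) - f3) -
        ((r + 3 : ℕ) - f1 - f3) * ((r + 3 : ℕ) - f2) -
        ((r + 3 : ℕ) - f2 - f3) * ((r + 3 : ℕ) - f1) + 2 * ((r + 3 : ℕ) - f1 - f2 - f3) := by
      have v1 : (s1 : ℤ) = f1 + f2 - o1 := by omega
      have v2 : (s2 : ℤ) = f1 + f3 - o2 := by omega
      have v3 : (s3 : ℤ) = f2 + f3 - o3 := by omega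
      have v4 : (f1 : ℤ) + f2 + f3 - o1 - o2 - o3 ≤ s := by omega
      rw [v1, v2, v3]
      have w1 : (0 : ℤ) ≤ o1 * (r + 1 - f3) := mul_nonneg (by positivity) (by omega)
      have w2 : (0 : ℤ) ≤ o2 * (r + 1 - f2) := mul_nonneg (by positivity) (by omega)
      have w3 : (0 : ℤ) ≤ o3 * (r + 1 - f1) := mul_nonneg (by positivity) (by omega)
      push_cast
      linarith
    refine (add_le_add_left (mul_le_mul_of_nonneg_right key (by positivity)) 1).trans ?_
    interval_cases f1 <;> interval_cases f2 <;> interval_cases f3 <;> push_cast <;>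
      (rw [← sub_nonneg]; ring_nf; positivity)

end Triangle

/-! ### Averaging over the recoloring of a vertex -/

section Resampling

variable {V α : Type*} [Fintype V] [DecidableEq V] [Fintype α]

/-- Exchanging `x v` with the new color `a` is an involution on pairs `(x, a)`. -/
theorem sum_sum_update (v : V) (F : (V → α) → ℤ) :
    ∑ x, ∑ a, F (Function.update x v a) = Fintype.card α * ∑ x, F x := by
  rw [← Fintype.sum_prod_type' (f := fun x a => F (Function.update x v a))]
  let e : (V → α) × α → (V → α) × α := fun p => (Function.update p.1 v p.2, p.1 v)
  have he : Function.Involutive e := by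
    rintro ⟨x, a⟩
    simp [e]
  have h := Equiv.sum_comp he.toPerm (fun p : (V → α) × α => F p.1)
  simp only [Function.Involutive.coe_toPerm, e] at h
  rw [h, Fintype.sum_prod_type]
  simp [mul_sum]

end Resampling

/-! ### Removing triangles from graphs of maximum degree three -/

section Subcubic

open scoped Classical

variable {V α : Type*} [Fintype V] [Fintype α] [DecidableEq α]

theorem listCount_univ_eq_sum (G : SimpleGraph V) :
    listCount G (fun _ => (univ : Finset α)) =
      ((∑ x : V → α, if ∀ u v, G.Adj u v → x u ≠ x v then (1 : ℤ) else 0 : ℤ) : ℝ) := by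
  rw [listCount, sum_boole]
  simp

/-- Removing the three vertices of a triangle in a graph of maximum degree at most three. -/
theorem listCount_deleteTriangle_le (hq : 2 ≤ Fintype.card α) (G : SimpleGraph V)
    (hdeg : ∀ v, G.degree v ≤ 3) {x y z : V} (hxy : G.Adj x y) (hxz : G.Adj x z)
    (hyz : G.Adj y z) :
    ∃ (G' : SimpleGraph V) (k : ℕ), G' < G ∧ #G.edgeFinset = #G'.edgeFinset + (3 + k) ∧
      (Fintype.card α : ℝ) ^ (3 + k) * listCount G (fun _ => (univ : Finset α)) ≤
        (((Fintype.card α : ℝ) - 1) ^ (3 + k) - 1) *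
          listCount G' (fun _ => (univ : Finset α)) := by
  set q := Fintype.card α with hqd
  set Nx := ((G.neighborFinset x).erase y).erase z with hNx
  set Ny := ((G.neighborFinset y).erase x).erase z with hNy
  set Nz := ((G.neighborFinset z).erase x).erase y with hNz
  have cx : #Nx + 2 = G.degree x := by
    rw [hNx, card_erase_of_mem (by simp [hxz, hyz.ne']), card_erase_of_mem (by simp [hxy]),
      SimpleGraph.card_neighborFinset_eq_degree]
    have : 1 < #(G.neighborFinset x) := one_lt_card.2 ⟨y, by simp [hxy], z, by simp [hxz], hyz.ne⟩
    rw [SimpleGraph.card_neighborFinset_eq_degree] at this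
    omega
  have cy : #Ny + 2 = G.degree y := by
    rw [hNy, card_erase_of_mem (by simp [hyz, hxz.ne']), card_erase_of_mem (by simp [hxy.symm]),
      SimpleGraph.card_neighborFinset_eq_degree]
    have : 1 < #(G.neighborFinset y) :=
      one_lt_card.2 ⟨x, by simp [hxy.symm], z, by simp [hyz], hxz.ne⟩
    rw [SimpleGraph.card_neighborFinset_eq_degree] at this
    omega
  have cz : #Nz + 2 = G.degree z := by
    rw [hNz, card_erase_of_mem (by simp [hyz.symm, hxy.ne']),
      card_erase_of_mem (by simp [hxz.symm]), SimpleGraph.card_neighborFinset_eq_degree]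
    have : 1 < #(G.neighborFinset z) :=
      one_lt_card.2 ⟨x, by simp [hxz.symm], y, by simp [hyz.symm], hxy.ne⟩
    rw [SimpleGraph.card_neighborFinset_eq_degree] at this
    omega
  have bx := hdeg x
  have bY := hdeg y
  have bz := hdeg z
  -- `k` counts the edges leaving the triangle, at most one per vertex, so `3 + k` edges disappear.
  refine ⟨((G.deleteIncidenceSet x).deleteIncidenceSet y).deleteIncidenceSet z,
    #Nx + #Ny + #Nz, ?_, ?_, ?_⟩
  · exact ((SimpleGraph.deleteIncidenceSet_le _ _).trans
      (SimpleGraph.deleteIncidenceSet_le _ _)).trans_lt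
      (deleteIncidenceSet_lt ((G.degree_pos_iff_exists_adj x).2 ⟨y, hxy⟩))
  · have e1 := G.card_edgeFinset_deleteIncidenceSet x
    have e2 := (G.deleteIncidenceSet x).card_edgeFinset_deleteIncidenceSet y
    have e3 := ((G.deleteIncidenceSet x).deleteIncidenceSet y).card_edgeFinset_deleteIncidenceSet z
    have b1 : G.degree x ≤ #G.edgeFinset := G.degree_le_card_edgeFinset _
    have b2 : (G.deleteIncidenceSet x).degree y ≤ #(G.deleteIncidenceSet x).edgeFinset :=
      SimpleGraph.degree_le_card_edgeFinset _ _
    have b3 : ((G.deleteIncidenceSet x).deleteIncidenceSet y).degree z ≤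
      #((G.deleteIncidenceSet x).deleteIncidenceSet y).edgeFinset :=
      SimpleGraph.degree_le_card_edgeFinset _ _
    have d1 : (G.deleteIncidenceSet x).degree y = G.degree y - 1 :=
      degree_deleteIncidenceSet_of_adj G hxy
    have d2 : (G.deleteIncidenceSet x).degree z = G.degree z - 1 :=
      degree_deleteIncidenceSet_of_adj G hxz
    have d3 : ((G.deleteIncidenceSet x).deleteIncidenceSet y).degree z =
        (G.deleteIncidenceSet x).degree z - 1 := by
      convert degree_deleteIncidenceSet_of_adj (G.deleteIncidenceSet x) (w := y) (u := z)
        (SimpleGraph.deleteIncidenceSet_adj.2 ⟨hyz, hxy.ne', hxz.ne'⟩)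
    have e4 : #G.edgeFinset = #(((G.deleteIncidenceSet x).deleteIncidenceSet y).deleteIncidenceSet
        z).edgeFinset + (3 + (#Nx + #Ny + #Nz)) := by omega
    convert e4
  · set G' := ((G.deleteIncidenceSet x).deleteIncidenceSet y).deleteIncidenceSet z with hG'
    have hadj : ∀ u v, G'.Adj u v ↔ G.Adj u v ∧ u ≠ x ∧ v ≠ x ∧ u ≠ y ∧ v ≠ y ∧ u ≠ z ∧ v ≠ z := by
      intro u v
      simp only [hG', SimpleGraph.deleteIncidenceSet_adj]
      tauto
    rw [listCount_univ_eq_sum, listCount_univ_eq_sum]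
    set P : (V → α) → Prop := fun φ => ∀ u v, G.Adj u v → φ u ≠ φ v with hP
    set P' : (V → α) → Prop := fun φ => ∀ u v, G'.Adj u v → φ u ≠ φ v with hP'
    set F : (V → α) → ℤ := fun φ => if P φ then 1 else 0 with hF
    -- Recolor `x`, `y`, `z` independently; the factor `q ^ 3` matches their free colors as isolated
    -- vertices of `G'`.
    have h3 : (q : ℤ) ^ 3 * ∑ φ, F φ = ∑ φ, ∑ a, ∑ b, ∑ c,
        F (Function.update (Function.update (Function.update φ x a) y b) z c) := by
      rw [sum_sum_update x (fun φ => ∑ b, ∑ c, F (Function.update (Function.update φ y b) z c)),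
        sum_sum_update y (fun φ => ∑ c, F (Function.update φ z c)), sum_sum_update]
      ring
    have hpt : ∀ φ : V → α, ∑ a, ∑ b, ∑ c,
        F (Function.update (Function.update (Function.update φ x a) y b) z c) ≤
        (if P' φ then 1 else 0) * ∑ a ∈ (Nx.image φ)ᶜ, ∑ b ∈ (Ny.image φ)ᶜ, ∑ c ∈ (Nz.image φ)ᶜ,
          if a ≠ b ∧ a ≠ c ∧ b ≠ c then (1 : ℤ) else 0 := by
      intro φ
      have e : ∀ a b c, F (Function.update (Function.update (Function.update φ x a) y b) z c) ≤
          (if P' φ then 1 else 0) * (if a ∈ (Nx.image φ)ᶜ then if b ∈ (Ny.image φ)ᶜ then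
            if c ∈ (Nz.image φ)ᶜ then if a ≠ b ∧ a ≠ c ∧ b ≠ c then (1 : ℤ) else 0
            else 0 else 0 else 0) := by
        intro a b c
        set ψ := Function.update (Function.update (Function.update φ x a) y b) z c with hψ
        have ψx : ψ x = a := by simp [hψ, hxy.ne, hxz.ne]
        have ψy : ψ y = b := by simp [hψ, hyz.ne]
        have ψz : ψ z = c := by simp [hψ]
        have ψv : ∀ v, v ≠ x → v ≠ y → v ≠ z → ψ v = φ v := by
          intro v h1 h2 h3; simp [hψ, h1, h2, h3]
        by_cases hψP : P ψ
        · have d1 : P' φ := by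
            intro u v huv
            obtain ⟨h0, h1, h2, h3, h4, h5, h6⟩ := (hadj u v).1 huv
            rw [← ψv u h1 h3 h5, ← ψv v h2 h4 h6]
            exact hψP u v h0
          have d2 : a ∈ (Nx.image φ)ᶜ := by
            rw [mem_compl, mem_image]
            rintro ⟨v, hv, rfl⟩
            simp only [hNx, mem_erase, SimpleGraph.mem_neighborFinset] at hv
            exact hψP x v hv.2.2 (by rw [ψx, ψv v hv.2.2.ne' hv.2.1 hv.1])
          have d3 : b ∈ (Ny.image φ)ᶜ := by
            rw [mem_compl, mem_image]
            rintro ⟨v, hv, rfl⟩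
            simp only [hNy, mem_erase, SimpleGraph.mem_neighborFinset] at hv
            exact hψP y v hv.2.2 (by rw [ψy, ψv v hv.2.1 hv.2.2.ne' hv.1])
          have d4 : c ∈ (Nz.image φ)ᶜ := by
            rw [mem_compl, mem_image]
            rintro ⟨v, hv, rfl⟩
            simp only [hNz, mem_erase, SimpleGraph.mem_neighborFinset] at hv
            exact hψP z v hv.2.2 (by rw [ψz, ψv v hv.2.1 hv.1 hv.2.2.ne'])
          have d5 : a ≠ b := by rw [← ψx, ← ψy]; exact hψP x y hxy
          have d6 : a ≠ c := by rw [← ψx, ← ψz]; exact hψP x z hxz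
          have d7 : b ≠ c := by rw [← ψy, ← ψz]; exact hψP y z hyz
          rw [if_pos d1, if_pos d2, if_pos d3, if_pos d4, if_pos ⟨d5, d6, d7⟩, hF]
          simp only [if_pos hψP]; norm_num
        · simp only [hF, if_neg hψP]
          refine mul_nonneg (by split_ifs <;> norm_num) (by split_ifs <;> norm_num)
      refine (sum_le_sum fun a _ => sum_le_sum fun b _ => sum_le_sum fun c _ => e a b c).trans_eq ?_
      simp_rw [← mul_sum]
      congr 1
      have s1 : ∀ (S : Finset α) (f : α → ℤ), ∑ a, (if a ∈ S then f a else 0) = ∑ a ∈ S, f a :=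
        fun S f => by rw [sum_ite_mem, univ_inter]
      refine Eq.trans (sum_congr rfl fun a _ => ?_) (s1 _ _)
      split_ifs with ha
      · refine Eq.trans (sum_congr rfl fun b _ => ?_) (s1 _ _)
        split_ifs with hb
        · exact s1 _ _
        · simp
      · simp
    have hcnt : ∀ φ : V → α, (q : ℤ) ^ (#Nx + #Ny + #Nz) * (∑ a ∈ (Nx.image φ)ᶜ,
        ∑ b ∈ (Ny.image φ)ᶜ, ∑ c ∈ (Nz.image φ)ᶜ, if a ≠ b ∧ a ≠ c ∧ b ≠ c then (1 : ℤ) else 0) ≤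
        ((q : ℤ) - 1) ^ (3 + (#Nx + #Ny + #Nz)) - 1 := by
      intro φ
      have i1 : ∀ S : Finset V, #S ≤ 1 → #(S.image φ) = #S := fun S hS =>
        card_image_of_injOn fun u hu v hv _ => card_le_one.1 hS u hu v hv
      have h := sum_distinct_triples_compl_lt hq (A := Nx.image φ) (B := Ny.image φ)
        (C := Nz.image φ) (card_image_le.trans (by omega)) (card_image_le.trans (by omega))
        (card_image_le.trans (by omega))
      rw [i1 Nx (by omega), i1 Ny (by omega), i1 Nz (by omega), ← hqd] at h
      rw [mul_comm]
      omega
    have main : (q : ℤ) ^ (3 + (#Nx + #Ny + #Nz)) * ∑ φ, F φ ≤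
        (((q : ℤ) - 1) ^ (3 + (#Nx + #Ny + #Nz)) - 1) * ∑ φ, if P' φ then 1 else 0 := by
      rw [pow_add, mul_right_comm, h3, mul_comm, mul_sum, mul_sum]
      refine sum_le_sum fun φ _ => ?_
      refine (mul_le_mul_of_nonneg_left (hpt φ) (by positivity)).trans ?_
      rw [mul_left_comm, mul_comm _ (if P' φ then (1 : ℤ) else 0)]
      exact mul_le_mul_of_nonneg_left (hcnt φ) (by split_ifs <;> norm_num)
    exact_mod_cast main

/-- Induction over subgraphs: a triangle is removed at a strict loss, and a triangle-free graph is
handled by the edge product. -/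
theorem listCount_le_of_degree_le_three (hq : 2 ≤ Fintype.card α) (G : SimpleGraph V)
    (hdeg : ∀ v, G.degree v ≤ 3) :
    listCount G (fun _ => (univ : Finset α)) ≤
      (Fintype.card α : ℝ) ^ Fintype.card V * edgeDensity α ^ #G.edgeFinset ∧
    ((∃ x y z, G.Adj x y ∧ G.Adj x z ∧ G.Adj y z) →
      listCount G (fun _ => (univ : Finset α)) <
        (Fintype.card α : ℝ) ^ Fintype.card V * edgeDensity α ^ #G.edgeFinset) := by
  have hne : Nonempty α := Fintype.card_pos_iff.1 (by omega)
  have hq1 : (2 : ℝ) ≤ Fintype.card α := by exact_mod_cast hq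
  have hρ := edgeDensity_pos hq
  have hρ1 := card_sub_one_le_mul_edgeDensity (α := α)
  induction G using WellFoundedLT.induction with
  | ind G ih =>
    by_cases hT : ∃ x y z, G.Adj x y ∧ G.Adj x z ∧ G.Adj y z
    · suffices h : listCount G (fun _ => (univ : Finset α)) <
        (Fintype.card α : ℝ) ^ Fintype.card V * edgeDensity α ^ #G.edgeFinset from
        ⟨h.le, fun _ => h⟩
      obtain ⟨x, y, z, hxy, hxz, hyz⟩ := hT
      obtain ⟨G', k, hlt, hk, hle⟩ := listCount_deleteTriangle_le hq G hdeg hxy hxz hyz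
      have hih := (ih G' hlt fun v => (SimpleGraph.degree_le_of_le hlt.le).trans (hdeg v)).1
      rw [hk]
      have hs : (0 : ℝ) < (Fintype.card α : ℝ) ^ (3 + k) := by positivity
      refine lt_of_mul_lt_mul_left ?_ hs.le
      have h1 : ((Fintype.card α : ℝ) - 1) ^ (3 + k) ≤
          (Fintype.card α * edgeDensity α) ^ (3 + k) :=
        pow_le_pow_left₀ (by linarith) hρ1 _
      have h0 : (1 : ℝ) ≤ ((Fintype.card α : ℝ) - 1) ^ (3 + k) := one_le_pow₀ (by linarith)
      have hB : 0 < (Fintype.card α : ℝ) ^ Fintype.card V * edgeDensity α ^ #G'.edgeFinset := by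
        positivity
      calc _ ≤ _ := hle
        _ ≤ (((Fintype.card α : ℝ) - 1) ^ (3 + k) - 1) *
            ((Fintype.card α : ℝ) ^ Fintype.card V * edgeDensity α ^ #G'.edgeFinset) := by
          exact mul_le_mul_of_nonneg_left hih (by linarith)
        _ < (Fintype.card α * edgeDensity α) ^ (3 + k) *
            ((Fintype.card α : ℝ) ^ Fintype.card V * edgeDensity α ^ #G'.edgeFinset) :=
          mul_lt_mul_of_pos_right (by linarith) hB
        _ = _ := by rw [mul_pow, pow_add (edgeDensity α)]; ring
    · refine ⟨?_, fun h => absurd h hT⟩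
      refine (listCount_le_edgeBound G _ fun a b c h1 h2 h3 => hT ⟨a, b, c, h1, h3, h2⟩).trans ?_
      exact edgeBound_univ_le G hdeg

end Subcubic

/-! ### How erasing one color affects bipartite counts -/

section StrictLocal

variable {α : Type*} [DecidableEq α]

theorem bipCount_lt_of_subset {a b : ℕ} (hb : b ≠ 0) {L L' M : Finset α} (hL : L ⊆ L') {z m : α}
    (hz : z ∈ L') (hz' : z ∉ L) (hm : m ∈ M) (hzm : z ≠ m) :
    bipCount a b L M < bipCount a b L' M := by
  have hsub : ∀ y : Fin a → α, avoid L y ⊆ avoid L' y := fun y => filter_subset_filter _ hL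
  refine sum_lt_sum (fun y _ => pow_le_pow_left₀ (by positivity)
    (by exact_mod_cast card_le_card (hsub y)) _) ⟨fun _ => m, by simp [hm], ?_⟩
  refine pow_lt_pow_left₀ ?_ (by positivity) hb
  exact_mod_cast card_lt_card ((ssubset_iff_of_subset (hsub _)).2
    ⟨z, mem_avoid.2 ⟨hz, fun _ => hzm⟩, fun h => hz' (mem_avoid.1 h).1⟩)

/-- Transpose `c` and `d` on one side. When `M` is everything this is a symmetry; when `M` lacks
`c`, tuples from `M` never block `c`, so sending `d` to `c` keeps a color available. -/
theorem bipCount_erase_le [Fintype α] (a b : ℕ) {c d : α} {M : Finset α}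
    (hM : M = univ ∨ M = univ.erase c) :
    bipCount a b (univ.erase c) M ≤ bipCount a b (univ.erase d) M := by
  by_cases hcd : c = d
  · rw [hcd]
  have hne : ∀ z, z ≠ c → Equiv.swap c d z ≠ d := by
    intro z hz h
    exact hz ((Equiv.swap c d).injective (h.trans (Equiv.swap_apply_left c d).symm))
  rcases hM with rfl | rfl
  · have hσ : ∀ y : Fin a → α, #(avoid (univ.erase c) y) ≤
        #(avoid (univ.erase d) (Equiv.swap c d ∘ y)) := by
      intro y
      refine card_le_card_of_injOn (Equiv.swap c d) (fun z hz => ?_)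
        (Equiv.swap c d).injective.injOn
      rw [mem_coe, mem_avoid, mem_erase] at hz ⊢
      exact ⟨⟨hne z hz.1.1, mem_univ _⟩, fun j h => hz.2 j ((Equiv.swap c d).injective h)⟩
    simp only [bipCount, Fintype.piFinset_univ]
    rw [← Equiv.sum_comp (Equiv.arrowCongr (Equiv.refl (Fin a)) (Equiv.swap c d))
      (fun y => (#(avoid (univ.erase d) y) : ℝ) ^ b)]
    refine sum_le_sum fun y _ => pow_le_pow_left₀ (by positivity) ?_ _
    exact_mod_cast hσ y
  · refine sum_le_sum fun y hy => pow_le_pow_left₀ (by positivity) ?_ _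
    have hy' : ∀ j, y j ≠ c := fun j => by
      rw [Fintype.mem_piFinset] at hy
      exact (mem_erase.1 (hy j)).1
    norm_cast
    refine card_le_card_of_injOn (Equiv.swap c d) (fun z hz => ?_)
      (Equiv.swap c d).injective.injOn
    rw [mem_coe, mem_avoid, mem_erase] at hz ⊢
    refine ⟨⟨hne z hz.1.1, mem_univ _⟩, fun j h => ?_⟩
    by_cases hzd : z = d
    · rw [hzd, Equiv.swap_apply_right] at h
      exact hy' j h.symm
    · rw [Equiv.swap_apply_of_ne_of_ne hz.1.1 hzd] at h
      exact hz.2 j h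

end StrictLocal

/-! ### Strictness when two vertices share some but not all neighbors -/

section StrictGlobal

open scoped Classical

variable {V α : Type*} [Fintype V] [Fintype α] [DecidableEq α]

/-- After `w` gets color `c`, remove `x`. The list at `u` already lacks `c`, so `x` taking `c` costs
nothing there while `d` does; at `v` the list is full and `c` is no better than `d`. These opposite
preferences make Hölder strict. Since `w` and `x` are not adjacent, `x` still has maximum degree 3.
-/
theorem listCount_condList_lt_edgeBound (G : SimpleGraph V)
    (hG : ∀ v, G.degree v = 3) (hT : ∀ a b c, G.Adj a b → G.Adj b c → ¬ G.Adj a c)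
    {w x u v : V} (hwx : w ≠ x) (hwu : G.Adj w u) (hxu : G.Adj x u) (hwv : ¬ G.Adj w v)
    (hxv : G.Adj x v) {c d : α} (hcd : c ≠ d) :
    listCount (G.deleteIncidenceSet w) (condList G (fun _ => (univ : Finset α)) w c) <
      edgeBound (G.deleteIncidenceSet w) (condList G (fun _ => (univ : Finset α)) w c) := by
  have hLn : ∀ u, G.Adj w u → condList G (fun _ => (univ : Finset α)) w c u = univ.erase c := by
    intro u hu; rw [condList, if_neg hu.ne', if_pos hu]
  have hLf : ∀ u, ¬ G.Adj w u → u ≠ w → condList G (fun _ => (univ : Finset α)) w c u = univ := by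
    intro u hu hne; rw [condList, if_neg hne, if_neg hu]
  have hLw : condList G (fun _ => (univ : Finset α)) w c w = {c} := if_pos rfl
  obtain ⟨G', hG'⟩ : ∃ G', G' = G.deleteIncidenceSet w := ⟨_, rfl⟩
  have hdn : ∀ u, G.Adj w u → G'.degree u = 2 := fun u hu => by
    subst hG'
    have := degree_deleteIncidenceSet_of_adj G hu
    rw [hG u] at this
    convert this
  have hdf : ∀ u, ¬ G.Adj w u → u ≠ w → G'.degree u = 3 := fun u hu hne => by
    subst hG'
    rw [← hG u]
    convert degree_deleteIncidenceSet_of_not_adj G hu hne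
  have hadj : ∀ u v, G'.Adj u v ↔ G.Adj u v ∧ u ≠ w ∧ v ≠ w := fun u v => by
    rw [hG', SimpleGraph.deleteIncidenceSet_adj]
  have hT' : ∀ a b c, G'.Adj a b → G'.Adj b c → ¬ G'.Adj a c := by
    subst hG'; exact triangleFree_deleteIncidenceSet hT w
  have hmax : ∀ v, G'.degree v ≤ 3 := fun v => by
    rw [← hG v]
    exact SimpleGraph.degree_le_of_le (hG' ▸ G.deleteIncidenceSet_le w)
  rw [← hG']
  generalize condList G (fun _ => (univ : Finset α)) w c = L at *
  have hwx' : ¬ G.Adj w x := hT w u x hwu hxu.symm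
  have hvw : v ≠ w := fun h => hwx' (h ▸ hxv.symm)
  have hx3 := hdf x hwx' hwx.symm
  have hdL : ∀ v, v ≠ w → d ∈ L v := by
    intro v hv
    by_cases h : G.Adj w v
    · rw [hLn v h]; simp [hcd.symm]
    · rw [hLf v h hv]; simp
  have hcL : ∀ v, v ≠ w → ¬ G.Adj w v → c ∈ L v := fun v hv h => by rw [hLf v h hv]; simp
  -- Color `d` survives in every list except that of `w`, and each remaining edge has an end outside
  -- `N(w)` where `c` survives too, so every edge count is positive.
  have hpos : 0 < edgeBound G' L := by
    refine mul_pos (prod_pos fun v _ => ?_) (prod_pos fun a _ => prod_pos fun b _ => ?_)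
    · split_ifs
      · by_cases hv : v = w
        · rw [hv, hLw]; simp
        · exact_mod_cast card_pos.2 ⟨d, hdL v hv⟩
      · exact one_pos
    · split_ifs with h
      · obtain ⟨h1, h2, h3⟩ := (hadj a b).1 h
        refine Real.rpow_pos_of_pos ?_ _
        by_cases hb : G.Adj w b
        · have ha : ¬ G.Adj w a := fun ha => hT w a b ha h1 hb
          exact bipCount_pos (hcL a h2 ha) (hdL b h3) hcd
        · exact bipCount_pos (hdL a h2) (hcL b h3 hb) hcd.symm
      · exact one_pos
  rw [listCount_eq_sum G' L x]
  refine (sum_le_sum fun e _ => listCount_le_edgeBound _ _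
    (triangleFree_deleteIncidenceSet hT' x)).trans_lt ?_
  refine (sum_edgeBound_deleteIncidenceSet_le G' L hT' (w := x) (by omega)
    (fun v => by rw [hx3]; exact hmax v)).2 hpos ⟨u, v, ?_, ?_, c, ?_, d, ?_, ?_, ?_⟩
  · exact (hadj x u).2 ⟨hxu, hwx.symm, hwu.ne'⟩
  · exact (hadj x v).2 ⟨hxv, hwx.symm, hvw⟩
  · exact hcL x hwx.symm hwx'
  · exact hdL x hwx.symm
  · have hu2 := hdn u hwu
    -- Besides `w` and `x`, `u` has one further neighbor `t`. Triangle-freeness keeps `t` outside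
    -- `N(w)`, so its list is full.
    have hcard : #((G'.neighborFinset u).erase x) = 1 := by
      rw [card_erase_of_mem, SimpleGraph.card_neighborFinset_eq_degree, hu2]
      rw [SimpleGraph.mem_neighborFinset]
      exact (hadj u x).2 ⟨hxu.symm, hwu.ne', hwx.symm⟩
    obtain ⟨t, ht⟩ := card_eq_one.1 hcard
    have htu : G'.Adj u t := by
      have : t ∈ (G'.neighborFinset u).erase x := by rw [ht]; simp
      rw [mem_erase, SimpleGraph.mem_neighborFinset] at this
      exact this.2
    obtain ⟨h1, -, h3⟩ := (hadj u t).1 htu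
    have hwt := hT w u t hwu h1
    simp only [condFactor, hu2, ht, prod_singleton, hdf t hwt h3, hLf t hwt h3, hLn u hwu]
    norm_num
    refine Real.rpow_lt_rpow (bipCount_nonneg _ _ _ _) ?_ (by norm_num)
    exact bipCount_lt_of_subset (by norm_num) (erase_subset _ _) (z := d) (m := c)
      (by simp [hcd.symm]) (by simp) (mem_univ _) hcd.symm
  · have hv3 := hdf v hwv hvw
    simp only [condFactor, hv3, hLf v hwv hvw]
    norm_num
    refine prod_le_prod (fun t _ => Real.rpow_nonneg (bipCount_nonneg _ _ _ _) _) fun t ht => ?_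
    refine Real.rpow_le_rpow (bipCount_nonneg _ _ _ _) (bipCount_erase_le _ _ ?_) (by positivity)
    rw [mem_erase, SimpleGraph.mem_neighborFinset, hadj] at ht
    by_cases h : G.Adj w t
    · exact Or.inr (hLn t h)
    · exact Or.inl (hLf t h ht.2.2.2)

theorem listCount_lt_edgeBound (hq : 2 ≤ Fintype.card α) (G : SimpleGraph V)
    (hG : ∀ v, G.degree v = 3) (hT : ∀ a b c, G.Adj a b → G.Adj b c → ¬ G.Adj a c)
    {w x u v : V} (hwx : w ≠ x) (hwu : G.Adj w u) (hxu : G.Adj x u) (hwv : ¬ G.Adj w v)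
    (hxv : G.Adj x v) :
    listCount G (fun _ => (univ : Finset α)) < edgeBound G (fun _ => (univ : Finset α)) := by
  rw [listCount_eq_sum G _ w]
  refine lt_of_lt_of_le ?_ (sum_edgeBound_deleteIncidenceSet_le G (fun _ => (univ : Finset α)) hT
    (w := w) (by rw [hG]; norm_num) (fun v => by rw [hG, hG])).1
  have : Nonempty α := Fintype.card_pos_iff.1 (by omega)
  have : Nontrivial α := Fintype.one_lt_card_iff_nontrivial.1 hq
  refine sum_lt_sum_of_nonempty univ_nonempty fun c _ => ?_
  obtain ⟨d, hd⟩ := exists_ne c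
  exact listCount_condList_lt_edgeBound G hG hT hwx hwu hxu hwv hxv hd.symm

end StrictGlobal

/-! ### Translating between colorings and counts -/

section Counting

/-- Proper colorings as functions. -/
def coloringEquiv {V α : Type*} (G : SimpleGraph V) :
    G.Coloring α ≃ {x : V → α // ∀ u v, G.Adj u v → x u ≠ x v} where
  toFun C := ⟨C, fun _ _ h => C.valid h⟩
  invFun x := SimpleGraph.Coloring.mk x.1 fun {u v} h => x.2 u v h
  left_inv _ := rfl
  right_inv _ := rfl

theorem numColorings_eq_listCount {V : Type*} [Fintype V] (G : SimpleGraph V) (q : ℕ) :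
    (numColorings G q : ℝ) = listCount G (fun _ => (univ : Finset (Fin q))) := by
  classical
  rw [numColorings, Nat.card_congr (coloringEquiv G), Nat.card_eq_fintype_card,
    Fintype.card_subtype, listCount, Fintype.piFinset_univ]

theorem numColorings_completeBipartiteGraph (a b q : ℕ) :
    (numColorings (completeBipartiteGraph (Fin b) (Fin a)) q : ℝ) =
      bipCount a b (univ : Finset (Fin q)) univ := by
  classical
  have e : {x : Fin b ⊕ Fin a → Fin q //
      ∀ u v, (completeBipartiteGraph (Fin b) (Fin a)).Adj u v → x u ≠ x v} ≃
      Σ y : Fin a → Fin q, (Fin b → avoid (univ : Finset (Fin q)) y) :=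
    { toFun := fun x => ⟨fun j => x.1 (Sum.inr j), fun i => ⟨x.1 (Sum.inl i),
        mem_avoid.2 ⟨mem_univ _, fun j => x.2 _ _ (by simp)⟩⟩⟩
      invFun := fun p => ⟨Sum.elim (fun i => (p.2 i : Fin q)) p.1, by
        rintro (i | i) (j | j) h
        · simp at h
        · exact (mem_avoid.1 (p.2 i).2).2 j
        · exact ((mem_avoid.1 (p.2 j).2).2 i).symm
        · simp at h⟩
      left_inv := fun x => by
        ext (i | i) <;> rfl
      right_inv := fun p => rfl }
  rw [numColorings, Nat.card_congr (coloringEquiv _), Nat.card_congr e, Nat.card_eq_fintype_card,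
    Fintype.card_sigma, bipCount, Fintype.piFinset_univ]
  push_cast
  refine sum_congr rfl fun y _ => ?_
  simp

theorem numColorings_of_iso_disjointCopies {V W : Type*} {G : SimpleGraph V} {H : SimpleGraph W}
    {k : ℕ} (e : G ≃g disjointCopies (Fin k) H) (q : ℕ) :
    numColorings G q = numColorings H q ^ k := by
  have f : {x : V → Fin q // ∀ u v, G.Adj u v → x u ≠ x v} ≃
      (Fin k → {x : W → Fin q // ∀ u v, H.Adj u v → x u ≠ x v}) :=
    { toFun := fun x i => ⟨fun w => x.1 (e.symm (i, w)), fun u v h =>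
        x.2 _ _ (e.symm.map_adj_iff.2 ⟨rfl, h⟩)⟩
      invFun := fun y => ⟨fun v => (y (e v).1).1 (e v).2, fun u v h => by
        obtain ⟨h1, h2⟩ := e.map_adj_iff.2 h
        dsimp only
        rw [h1]
        exact (y (e v).1).2 _ _ h2⟩
      left_inv := fun x => by
        ext v
        simp
      right_inv := fun y => by
        ext i w
        simp }
  rw [numColorings, Nat.card_congr (coloringEquiv G), Nat.card_congr f, Nat.card_fun,
    Nat.card_fin, numColorings, Nat.card_congr (coloringEquiv H)]

end Counting

/-! ### Equal neighborhoods force copies of `K_{3,3}` -/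

section Structure

/-- In each component fix an edge from `r` to `s`. Then `N(r)` and `N(s)` are disjoint and
independent by triangle-freeness, completely joined by `h`, and together exhaust the component. -/
theorem isUnionOfCopies_of_neighbors {V : Type*} [Fintype V] (G : SimpleGraph V)
    [DecidableRel G.Adj] (hG : ∀ v, G.degree v = 3)
    (hT : ∀ a b c, G.Adj a b → G.Adj b c → ¬ G.Adj a c)
    (h : ∀ w x u, G.Adj w u → G.Adj x u → ∀ v, G.Adj x v → G.Adj w v) :
    IsUnionOfCopies G (completeBipartiteGraph (Fin 3) (Fin 3)) := by
  classical
  have hnb : ∀ v, Nonempty (Fin 3 ≃ G.neighborFinset v) := fun v =>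
    ⟨(finCongr (by simp [hG v])).trans (G.neighborFinset v).equivFin.symm⟩
  let nb : ∀ v, Fin 3 ≃ G.neighborFinset v := fun v => Classical.choice (hnb v)
  have hadjnb : ∀ v i, G.Adj v (nb v i) := fun v i =>
    (G.mem_neighborFinset v _).1 (nb v i).2
  have hnbsurj : ∀ v u, G.Adj v u → ∃ i, (nb v i : V) = u := fun v u hu =>
    ⟨(nb v).symm ⟨u, by simpa using hu⟩, by simp⟩
  obtain ⟨k, ⟨e⟩⟩ := Finite.exists_equiv_fin G.ConnectedComponent
  let r : Fin k → V := fun i => (e.symm i).out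
  have hr : ∀ i, G.connectedComponentMk (r i) = e.symm i := fun i => Quot.out_eq _
  let s : Fin k → V := fun i => nb (r i) 0
  have hrs : ∀ i, G.Adj (r i) (s i) := fun i => hadjnb _ _
  let φ : Fin k × (Fin 3 ⊕ Fin 3) → V := fun p =>
    Sum.elim (fun i => (nb (r p.1) i : V)) (fun j => (nb (s p.1) j : V)) p.2
  have hcomp : ∀ p, G.connectedComponentMk (φ p) = e.symm p.1 := by
    rintro ⟨c, i | j⟩
    · rw [← hr]
      exact SimpleGraph.ConnectedComponent.sound (hadjnb (r c) i).symm.reachable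
    · rw [← hr]
      exact SimpleGraph.ConnectedComponent.sound
        ((hadjnb (s c) j).symm.reachable.trans (hrs c).symm.reachable)
  have hfst : ∀ p p', G.Reachable (φ p) (φ p') → p.1 = p'.1 := fun p p' hp => by
    have := SimpleGraph.ConnectedComponent.sound hp
    rw [hcomp, hcomp] at this
    exact e.symm.injective this
  have hinj : Function.Injective φ := by
    rintro ⟨c, x⟩ ⟨c', x'⟩ hp
    obtain rfl : c = c' := hfst (c, x) (c', x') (by rw [hp])
    rcases x with i | i <;> rcases x' with j | j
    · have : nb (r c) i = nb (r c) j := Subtype.ext hp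
      rw [(nb (r c)).injective this]
    · have h1 := hadjnb (r c) i
      have h2 := hadjnb (s c) j
      have hp' : (nb (r c) i : V) = nb (s c) j := hp
      rw [← hp'] at h2
      exact absurd h1 (hT _ _ _ (hrs c) h2)
    · have h1 := hadjnb (r c) j
      have h2 := hadjnb (s c) i
      have hp' : (nb (s c) i : V) = nb (r c) j := hp
      rw [hp'] at h2
      exact absurd h1 (hT _ _ _ (hrs c) h2)
    · have : nb (s c) i = nb (s c) j := Subtype.ext hp
      rw [(nb (s c)).injective this]
  have hsurj : Function.Surjective φ := by
    intro v
    obtain ⟨c, hc⟩ : ∃ c, c = e (G.connectedComponentMk v) := ⟨_, rfl⟩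
    have hreach : G.Reachable (r c) v := by
      refine SimpleGraph.ConnectedComponent.exact ?_
      rw [hr, hc, Equiv.symm_apply_apply]
    clear hc
    -- A walk from `r` alternates between `N(s)` and `N(r)`: by `h`, each step from one set lands in
    -- the other.
    have key : G.Adj (r c) v ∨ G.Adj (s c) v := by
      rw [SimpleGraph.reachable_iff_reflTransGen] at hreach
      induction hreach with
      | refl => exact Or.inr (hrs c).symm
      | @tail a b _ hab ih =>
        rcases ih with ih | ih
        · exact Or.inr (h b (r c) a hab.symm ih (s c) (hrs c)).symm
        · exact Or.inl (h (r c) a (s c) (hrs c) ih.symm b hab)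
    rcases key with h1 | h1
    · obtain ⟨i, hi⟩ := hnbsurj _ _ h1
      exact ⟨(c, Sum.inl i), hi⟩
    · obtain ⟨i, hi⟩ := hnbsurj _ _ h1
      exact ⟨(c, Sum.inr i), hi⟩
  have hcross : ∀ c i j, G.Adj (nb (r c) i) (nb (s c) j) := fun c i j =>
    (h (nb (s c) j) (r c) (s c) (hadjnb (s c) j).symm (hrs c) _ (hadjnb (r c) i)).symm
  refine ⟨k, ⟨SimpleGraph.Iso.symm ⟨Equiv.ofBijective φ ⟨hinj, hsurj⟩, ?_⟩⟩⟩
  rintro ⟨c, x⟩ ⟨c', x'⟩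
  simp only [disjointCopies]
  constructor
  · intro hp
    obtain rfl : c = c' := hfst (c, x) (c', x') (SimpleGraph.Adj.reachable hp)
    refine ⟨rfl, ?_⟩
    rcases x with i | i <;> rcases x' with j | j
    · exact absurd (hadjnb (r c) j) (hT _ _ _ (hadjnb (r c) i) hp)
    · simp
    · simp
    · exact absurd (hadjnb (s c) j) (hT _ _ _ (hadjnb (s c) i) hp)
  · rintro ⟨h1, h2⟩
    obtain rfl : c = c' := h1
    rcases x with i | i <;> rcases x' with j | j
    · simp at h2
    · exact hcross c i j
    · exact (hcross c j i).symm
    · simp at h2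

end Structure

/-! ### Cubic graphs and the equality case -/

section Cubic

open scoped Classical

variable {V : Type*} [Fintype V]

/-- From `3n = 2e` the exponent `e / 9` equals `n / 6`, and the powers of `q` cancel. -/
theorem card_pow_mul_edgeDensity_pow_of_cubic (G : SimpleGraph V) (hG : ∀ v, G.degree v = 3)
    {q : ℕ} (hq : 2 ≤ q) :
    (Fintype.card (Fin q) : ℝ) ^ Fintype.card V * edgeDensity (Fin q) ^ #G.edgeFinset =
      bipCount 3 3 (univ : Finset (Fin q)) univ ^ ((Fintype.card V : ℝ) / 6) := by
  have hq0 : (0 : ℝ) < q := by positivity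
  have h2 : 3 * (Fintype.card V : ℝ) = 2 * #G.edgeFinset := by
    have := G.sum_degrees_eq_twice_card_edges
    simp only [hG, sum_const, card_univ, smul_eq_mul] at this
    rw [mul_comm]
    exact_mod_cast this
  rw [edgeDensity, bipDensity, ← Real.rpow_natCast, ← Real.rpow_natCast, ← Real.rpow_mul
    (div_nonneg (bipCount_nonneg _ _ _ _) (by positivity)), Fintype.card_fin,
    show (1 : ℝ) / 9 * #G.edgeFinset = Fintype.card V / 6 by linarith,
    Real.div_rpow (bipCount_nonneg _ _ _ _) (by positivity), ← Real.rpow_natCast,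
    ← Real.rpow_mul hq0.le]
  have : ((3 + 3 : ℕ) : ℝ) * (Fintype.card V / 6) = Fintype.card V := by push_cast; ring
  rw [this]
  field_simp

theorem numColorings_le_of_cubic (G : SimpleGraph V) (hG : ∀ v, G.degree v = 3)
    {q : ℕ} (hq : 2 ≤ q) :
    (numColorings G q : ℝ) ≤
      bipCount 3 3 (univ : Finset (Fin q)) univ ^ ((Fintype.card V : ℝ) / 6) ∧
    (¬ IsUnionOfCopies G (completeBipartiteGraph (Fin 3) (Fin 3)) → (numColorings G q : ℝ) <
      bipCount 3 3 (univ : Finset (Fin q)) univ ^ ((Fintype.card V : ℝ) / 6)) := by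
  have hq' : 2 ≤ Fintype.card (Fin q) := by simpa using hq
  have hne : Nonempty (Fin q) := ⟨⟨0, by omega⟩⟩
  have hdeg : ∀ v, G.degree v ≤ 3 := fun v => (hG v).le
  rw [numColorings_eq_listCount, ← card_pow_mul_edgeDensity_pow_of_cubic G hG hq]
  obtain ⟨hle, hlt⟩ := listCount_le_of_degree_le_three hq' G hdeg
  refine ⟨hle, fun hU => ?_⟩
  by_cases hT : ∃ x y z, G.Adj x y ∧ G.Adj x z ∧ G.Adj y z
  · exact hlt hT
  · have hT' : ∀ a b c, G.Adj a b → G.Adj b c → ¬ G.Adj a c :=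
      fun a b c h1 h2 h3 => hT ⟨a, b, c, h1, h3, h2⟩
    by_cases h : ∀ w x u, G.Adj w u → G.Adj x u → ∀ v, G.Adj x v → G.Adj w v
    · exact absurd (isUnionOfCopies_of_neighbors G hG hT' h) hU
    · push Not at h
      obtain ⟨w, x, u, hwu, hxu, v, hxv, hwv⟩ := h
      have hwx : w ≠ x := by rintro rfl; exact hwv hxv
      exact (listCount_lt_edgeBound hq' G hG hT' hwx hwu hxu hwv hxv).trans_le
        (edgeBound_univ_le G hdeg)

end Cubic

theorem mainTheorem2 {V : Type*} [Fintype V] [Nonempty V] (G : SimpleGraph V)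
    [DecidableRel G.Adj] (hG : G.IsRegularOfDegree 3) (q : ℕ) (hq : 2 ≤ q) :
    (numColorings G q : ℝ) ^ ((1 : ℝ) / (Fintype.card V : ℝ)) ≤
        (numColorings (completeBipartiteGraph (Fin 3) (Fin 3)) q : ℝ) ^ ((1 : ℝ) / 6) ∧
      ((numColorings G q : ℝ) ^ ((1 : ℝ) / (Fintype.card V : ℝ)) =
          (numColorings (completeBipartiteGraph (Fin 3) (Fin 3)) q : ℝ) ^ ((1 : ℝ) / 6) ↔
        IsUnionOfCopies G (completeBipartiteGraph (Fin 3) (Fin 3))) := by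
  have hV : (0 : ℝ) < Fintype.card V := by exact_mod_cast Fintype.card_pos
  set K := bipCount 3 3 (univ : Finset (Fin q)) univ with hK
  have hK0 : 0 ≤ K := bipCount_nonneg _ _ _ _
  have hKV : (K ^ ((Fintype.card V : ℝ) / 6)) ^ ((1 : ℝ) / Fintype.card V) = K ^ ((1 : ℝ) / 6) := by
    rw [← Real.rpow_mul hK0]; congr 1; field_simp
  rw [numColorings_completeBipartiteGraph, ← hK, ← hKV]
  obtain ⟨hle, hlt⟩ := numColorings_le_of_cubic G (fun v => by rw [← hG v]; congr!) hq
  refine ⟨Real.rpow_le_rpow (by positivity) hle (by positivity), fun heq => ?_, ?_⟩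
  · by_contra hU
    exact (Real.rpow_lt_rpow (by positivity) (hlt hU) (by positivity)).ne heq
  · rintro ⟨k, ⟨e⟩⟩
    have hcard : Fintype.card V = k * 6 := by
      rw [Fintype.card_congr e.toEquiv]; simp
    rw [numColorings_of_iso_disjointCopies e, Nat.cast_pow, numColorings_completeBipartiteGraph,
      ← hK, hcard]
    congr 1
    rw [← Real.rpow_natCast]
    congr 1
    push_cast
    field_simp
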